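/- Let $p$ be a prime and let $R$ be a regular (commutative, Noetherian) ring of characteristic $p$ that is $F$-finite, i.e. finitely generated as a module over its subring $R^{p}$ of $p$-th powers. For $g\in R$ and $s\ge 1$ define the ideal $I_s(g)\subseteq R$ as follows. If $R$ is a free module over the subring $R^{p^s}$ of $p^s$-th powers, $I_s(g)$ is the ideal generated by the elements $c_1,c_2,\dots$, where $c_1^{p^s},c_2^{p^s},\dots$ are the coordinates of $g$ in an $R^{p^s}$-basis of $R$ (this does not depend on the basis). In general $\operatorname{Spec} R$ is covered by basic open sets $\operatorname{Spec} R_r$ with $R_r$ free over $(R_r)^{p^s}$, and $I_s(g)$ is obtained by glueing the ideals so defined in the rings $R_r$. Let $D_R$ be the ring of differential operators of $R$: the additive maps $\delta:R\to R$ that are of order $\le n$ for some $n\ge 0$, where order $\le 0$ means multiplication by an element of $R$, and order $\le n$ (for $n\ge1$) means that for every $r\in R$ the commutator of $\delta$ with multiplication by $r$ is of order $\le n-1$. For $f\in R$, the localization $R_f$ carries its unique $D_R$-module structure for which $R\to R_f$ is $D_R$-linear. Then for every $f\in R$ the ideals $I_s(f^{p^s-1})$ form a descending chain $$I_1(f^{p-1})\supseteq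 I_2(f^{p^2-1})\supseteq I_3(f^{p^3-1})\supseteq\cdots,$$ and this chain stabilizes (there is $s\ge1$ with $I_t(f^{p^t-1})=I_s(f^{p^s-1})$ for all $t\ge s$) if and only if $\frac1f$ generates $R_f$ as a $D_R$-module. -/

import Mathlib

/-! Differential operators on a commutative ring. -/

namespace CharPDMod

/-- Multiplication by an element of `R`, as an additive endomorphism of `R`. -/
def mulOp {R : Type*} [CommRing R] : R →+* AddMonoid.End R := Module.toAddMonoidEnd R R

@[simp] theorem mulOp_apply {R : Type*} [CommRing R] (a x : R) : mulOp a x = a * x := rfl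

@[simp] theorem end_add_apply {R : Type*} [CommRing R] (δ ε : AddMonoid.End R) (x : R) :
    (δ + ε) x = δ x + ε x := rfl

@[simp] theorem end_neg_apply {R : Type*} [CommRing R] (δ : AddMonoid.End R) (x : R) :
    (-δ) x = -δ x := rfl

@[simp] theorem end_sub_apply {R : Type*} [CommRing R] (δ ε : AddMonoid.End R) (x : R) :
    (δ - ε) x = δ x - ε x := rfl

@[simp] theorem end_mul_apply {R : Type*} [CommRing R] (δ ε : AddMonoid.End R) (x : R) :
    (δ * ε) x = δ (ε x) := rfl

@[simp] theorem end_zero_apply {R : Type*} [CommRing R] (x : R) :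
    (0 : AddMonoid.End R) x = 0 := rfl

/-- The commutator `δ ∘ r - r ∘ δ` of an additive map with the multiplication by `r`. -/
def comm {R : Type*} [CommRing R] (δ : AddMonoid.End R) (r : R) : AddMonoid.End R :=
  δ * mulOp r - mulOp r * δ

@[simp] theorem comm_apply {R : Type*} [CommRing R] (δ : AddMonoid.End R) (r x : R) :
    comm δ r x = δ (r * x) - r * δ x := rfl

/-- `IsDiffOp n δ`: the additive map `δ : R → R` is a differential operator of order `≤ n`.
Order `0` means multiplication by an element of `R`; order `≤ n + 1` means that all commutators
with multiplications by elements of `R` have order `≤ n`. -/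
def IsDiffOp {R : Type*} [CommRing R] : ℕ → AddMonoid.End R → Prop
  | 0, δ => ∃ a : R, δ = mulOp a
  | n + 1, δ => ∀ r : R, IsDiffOp n (comm δ r)

section Closure

variable {R : Type*} [CommRing R]

theorem IsDiffOp.zero (n : ℕ) : IsDiffOp n (0 : AddMonoid.End R) := by
  induction n with
  | zero => exact ⟨0, by simp⟩
  | succ n ih => intro r; simpa [comm] using ih

theorem IsDiffOp.succ {n : ℕ} {δ : AddMonoid.End R} (h : IsDiffOp n δ) : IsDiffOp (n + 1) δ := by
  induction n generalizing δ with
  | zero =>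
    obtain ⟨a, rfl⟩ := h
    intro r
    have : comm (mulOp a) r = 0 := by ext x; simp; ring
    rw [this]; exact IsDiffOp.zero 0
  | succ n ih => intro r; exact ih (h r)

theorem IsDiffOp.mono {m n : ℕ} (hmn : m ≤ n) {δ : AddMonoid.End R} (h : IsDiffOp m δ) :
    IsDiffOp n δ := by
  induction hmn with
  | refl => exact h
  | step _ ih => exact ih.succ

theorem IsDiffOp.add {n : ℕ} {δ ε : AddMonoid.End R} (h : IsDiffOp n δ) (h' : IsDiffOp n ε) :
    IsDiffOp n (δ + ε) := by
  induction n generalizing δ ε with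
  | zero =>
    obtain ⟨a, rfl⟩ := h
    obtain ⟨b, rfl⟩ := h'
    exact ⟨a + b, by simp⟩
  | succ n ih =>
    intro r
    have : comm (δ + ε) r = comm δ r + comm ε r := by ext x; simp; ring
    rw [this]; exact ih (h r) (h' r)

theorem IsDiffOp.neg {n : ℕ} {δ : AddMonoid.End R} (h : IsDiffOp n δ) : IsDiffOp n (-δ) := by
  induction n generalizing δ with
  | zero =>
    obtain ⟨a, rfl⟩ := h
    exact ⟨-a, by simp⟩
  | succ n ih =>
    intro r
    have : comm (-δ) r = -comm δ r := by ext x; simp; ring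
    rw [this]; exact ih (h r)

theorem IsDiffOp.sub {n : ℕ} {δ ε : AddMonoid.End R} (h : IsDiffOp n δ) (h' : IsDiffOp n ε) :
    IsDiffOp n (δ - ε) := by
  rw [sub_eq_add_neg]; exact h.add h'.neg

theorem IsDiffOp.mulOp_left {n : ℕ} {δ : AddMonoid.End R} (h : IsDiffOp n δ) (a : R) :
    IsDiffOp n (mulOp a * δ) := by
  induction n generalizing δ with
  | zero =>
    obtain ⟨b, rfl⟩ := h
    exact ⟨a * b, by simp⟩
  | succ n ih =>
    intro r
    have : comm (mulOp a * δ) r = mulOp a * comm δ r := by ext x; simp; ring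
    rw [this]; exact ih (h r)

theorem IsDiffOp.mulOp_right {n : ℕ} {δ : AddMonoid.End R} (h : IsDiffOp n δ) (a : R) :
    IsDiffOp n (δ * mulOp a) := by
  induction n generalizing δ with
  | zero =>
    obtain ⟨b, rfl⟩ := h
    exact ⟨b * a, by simp⟩
  | succ n ih =>
    intro r
    have : comm (δ * mulOp a) r = comm δ r * mulOp a := by
      ext x; simp [mul_left_comm]
    rw [this]; exact ih (h r)

theorem IsDiffOp.mul {m n : ℕ} {δ ε : AddMonoid.End R} (h : IsDiffOp m δ) (h' : IsDiffOp n ε) :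
    IsDiffOp (m + n) (δ * ε) := by
  induction m generalizing n δ ε with
  | zero =>
    obtain ⟨a, rfl⟩ := h
    rw [zero_add]; exact h'.mulOp_left a
  | succ m ihm =>
    induction n generalizing ε with
    | zero =>
      obtain ⟨b, rfl⟩ := h'
      exact h.mulOp_right b
    | succ n ihn =>
      intro r
      have : comm (δ * ε) r = δ * comm ε r + comm δ r * ε := by ext x; simp
      rw [this]
      refine IsDiffOp.add (ihn (h' r)) ?_
      have := ihm (h r) h'
      rwa [show m + (n + 1) = m + 1 + n by omega] at this

end Closure

/-- The ring `D_R` of differential operators of `R`, a subring of the ring of all additive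
endomorphisms of `R`. -/
def diffOps (R : Type*) [CommRing R] : Subring (AddMonoid.End R) where
  carrier := {δ | ∃ n, IsDiffOp n δ}
  mul_mem' := by
    rintro _ _ ⟨m, hm⟩ ⟨n, hn⟩; exact ⟨_, hm.mul hn⟩
  one_mem' := ⟨0, 1, by simp⟩
  add_mem' := by
    rintro _ _ ⟨m, hm⟩ ⟨n, hn⟩
    exact ⟨max m n, (hm.mono (le_max_left m n)).add (hn.mono (le_max_right m n))⟩
  zero_mem' := ⟨0, IsDiffOp.zero 0⟩
  neg_mem' := by
    rintro _ ⟨m, hm⟩; exact ⟨m, hm.neg⟩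

/-! The action of `D_R` on a localization of `R`: every differential operator of `R` extends
uniquely to a differential operator of the localization. -/

section Extension

variable {R : Type*} [CommRing R] {S : Type*} [CommRing S] [Algebra R S]

/-- The additive endomorphism `δ'` of the `R`-algebra `S` extends the one `δ` of `R`. -/
def Extends (δ' : AddMonoid.End S) (δ : AddMonoid.End R) : Prop :=
  ∀ x : R, δ' (algebraMap R S x) = algebraMap R S (δ x)

theorem Extends.comm {δ' : AddMonoid.End S} {δ : AddMonoid.End R} (h : Extends δ' δ) (r : R) :
    Extends (comm δ' (algebraMap R S r)) (comm δ r) := by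
  intro x
  have h1 := h (r * x)
  rw [map_mul] at h1
  simp [h1, h x]


theorem eq_zero_of_vanish (M : Submonoid R) [IsLocalization M S] {n : ℕ} {δ : AddMonoid.End S} (h : IsDiffOp n δ)
    (h0 : ∀ x : R, δ (algebraMap R S x) = 0) : δ = 0 := by
  induction n generalizing δ with
  | zero =>
    obtain ⟨a, rfl⟩ := h
    have := h0 1
    simp only [map_one, mulOp_apply, mul_one] at this
    simp [this]
  | succ n ih =>
    have hc : ∀ r : R, comm δ (algebraMap R S r) = 0 := fun r =>
      ih (h _) (fun x => by
        have := h0 (r * x)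
        rw [map_mul] at this
        simp [this, h0 x])
    ext z
    obtain ⟨⟨x, s⟩, hz⟩ := IsLocalization.surj M z
    have h1 := DFunLike.congr_fun (hc s) z
    rw [comm_apply, mul_comm, hz, h0, zero_sub] at h1
    exact (IsLocalization.map_units S s).mul_left_cancel (by simpa using h1)

theorem Extends.unique (M : Submonoid R) [IsLocalization M S] {m n : ℕ} {δ₁ δ₂ : AddMonoid.End S} {δ : AddMonoid.End R}
    (h₁ : IsDiffOp m δ₁) (h₂ : IsDiffOp n δ₂) (e₁ : Extends δ₁ δ) (e₂ : Extends δ₂ δ) :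
    δ₁ = δ₂ :=
  sub_eq_zero.mp <| eq_zero_of_vanish M
    ((h₁.mono (le_max_left m n)).sub (h₂.mono (le_max_right m n)))
    (fun x => by simp [e₁ x, e₂ x])

theorem exists_extends (M : Submonoid R) (S : Type*) [CommRing S] [Algebra R S] [IsLocalization M S] {n : ℕ}
    {δ : AddMonoid.End R} (h : IsDiffOp n δ) :
    ∃ δ' : AddMonoid.End S, IsDiffOp n δ' ∧ Extends δ' δ := by
  induction n generalizing δ with
  | zero =>
    obtain ⟨a, rfl⟩ := h
    exact ⟨mulOp (algebraMap R S a), ⟨_, rfl⟩, fun x => by simp⟩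
  | succ n ih =>
    choose D hD hE using fun r => ih (h r)
    have hcan : ∀ (s : M) {a b : S}, algebraMap R S s * a = algebraMap R S s * b → a = b :=
      fun s _ _ e => (IsLocalization.map_units S s).mul_left_cancel e
    have hswap : ∀ r t : R, CharPDMod.comm (D r) (algebraMap R S t) =
        CharPDMod.comm (D t) (algebraMap R S r) := by
      intro r t
      refine Extends.unique M (n := n) (m := n) ((hD r).succ _) ((hD t).succ _)
        ((hE r).comm t) ?_
      have : CharPDMod.comm (CharPDMod.comm δ r) t = CharPDMod.comm (CharPDMod.comm δ t) r := by
        ext x; simp [mul_left_comm]; ring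
      rw [this]; exact (hE t).comm r
    have hker : ∀ x y : R, algebraMap R S x = algebraMap R S y →
        algebraMap R S (δ x) = algebraMap R S (δ y) := by
      intro x y hxy
      obtain ⟨u, hu⟩ := (IsLocalization.eq_iff_exists M S).mp hxy
      apply hcan u
      have hx := hE u x
      have hy := hE u y
      rw [hxy, hy] at hx
      simp only [comm_apply, map_sub, map_mul, hu] at hx
      linear_combination hx
    have hwd : ∀ (z : S) (x y : R) (s t : M), algebraMap R S s * z = algebraMap R S x →
        algebraMap R S t * z = algebraMap R S y →
        algebraMap R S t * (algebraMap R S (δ x) - D s z) =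
          algebraMap R S s * (algebraMap R S (δ y) - D t z) := by
      intro z x y s t hx hy
      have h1 := hE t x
      have h2 := hE s y
      have h3 := DFunLike.congr_fun (hswap s t) z
      have h4 := hker (t * x) (s * y) (by rw [map_mul, map_mul, ← hx, ← hy]; ring)
      simp only [comm_apply, map_sub, map_mul] at h1 h2 h3
      rw [← hx] at h1
      rw [← hy] at h2
      linear_combination h4 - h2 + h1 + h3
    have hex : ∀ z : S, ∃ w : S, ∀ (x : R) (s : M), algebraMap R S s * z = algebraMap R S x →
        algebraMap R S s * w = algebraMap R S (δ x) - D s z := by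
      intro z
      obtain ⟨⟨y, t⟩, hz⟩ := IsLocalization.surj M z
      obtain ⟨v, hv⟩ := (IsLocalization.map_units S t).exists_right_inv
      refine ⟨v * (algebraMap R S (δ y) - D t z), fun x s hx => ?_⟩
      apply hcan t
      rw [hwd z x y s t hx (by rw [mul_comm]; exact hz)]
      linear_combination
        (algebraMap R S s * (algebraMap R S (δ y) - D t z)) * hv
    choose w hw using hex
    have hadd : ∀ z₁ z₂ : S, w (z₁ + z₂) = w z₁ + w z₂ := by
      intro z₁ z₂
      obtain ⟨⟨x, s⟩, h1⟩ := IsLocalization.surj M z₁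
      obtain ⟨⟨y, t⟩, h2⟩ := IsLocalization.surj M z₂
      simp only at h1 h2
      have e1 : algebraMap R S ((s * t : M) : R) * z₁ = algebraMap R S (t * x) := by
        simp only [Submonoid.coe_mul, map_mul, ← h1]; ring
      have e2 : algebraMap R S ((s * t : M) : R) * z₂ = algebraMap R S (s * y) := by
        simp only [Submonoid.coe_mul, map_mul, ← h2]; ring
      have e3 : algebraMap R S ((s * t : M) : R) * (z₁ + z₂) =
          algebraMap R S (t * x + s * y) := by
        rw [mul_add, e1, e2, map_add]
      apply hcan (s * t)
      rw [mul_add, hw _ _ _ e1, hw _ _ _ e2, hw _ _ _ e3]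
      simp only [map_add]; ring
    let δ' : AddMonoid.End S := AddMonoidHom.mk' w hadd
    have hδ' : ∀ z, δ' z = w z := fun _ => rfl
    have hcomm : ∀ r : R, CharPDMod.comm δ' (algebraMap R S r) = D r := by
      intro r
      ext z
      obtain ⟨⟨x, s⟩, h1⟩ := IsLocalization.surj M z
      simp only at h1
      rw [mul_comm] at h1
      have e2 : algebraMap R S (s : R) * (algebraMap R S r * z) = algebraMap R S (r * x) := by
        rw [map_mul, ← h1]; ring
      have w1 := hw _ _ _ h1
      have w2 := hw _ _ _ e2
      have h2 := hE r x
      have h3 := DFunLike.congr_fun (hswap r s) z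
      simp only [comm_apply, map_sub, map_mul] at h2 h3
      rw [← h1] at h2
      apply hcan s
      rw [comm_apply, hδ', hδ']
      linear_combination w2 - algebraMap R S r * w1 - h2 + h3
    refine ⟨δ', ?_, ?_⟩
    · intro a
      obtain ⟨⟨x, s⟩, h1⟩ := IsLocalization.surj M a
      simp only at h1
      obtain ⟨v, hv⟩ := (IsLocalization.map_units S s).exists_right_inv
      have : CharPDMod.comm δ' a = mulOp v * (D x - D s * mulOp a) := by
        ext z
        simp only [← hcomm, end_mul_apply, end_sub_apply, comm_apply,
          mulOp_apply, ← h1]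
        rw [show a * algebraMap R S s * z = algebraMap R S s * (a * z) by ring]
        linear_combination (a * δ' z - δ' (a * z)) * hv
      rw [this]
      exact ((hD x).sub ((hD s).mulOp_right a)).mulOp_left v
    · intro x
      have h1 := hw (algebraMap R S x) x 1 (by simp)
      have h2 : D ((1 : M) : R) = 0 := by
        rw [← hcomm]; ext z; simp
      rw [h2] at h1
      simpa [hδ'] using h1

/-- The unique differential operator on the localization that extends `δ`. -/
theorem existsUnique_extends (M : Submonoid R) (δ : diffOps R) :
    ∃! δ' : AddMonoid.End (Localization M), (∃ n, IsDiffOp n δ') ∧ Extends δ' (δ : AddMonoid.End R) := by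
  obtain ⟨n, hn⟩ := δ.2
  obtain ⟨δ', h1, h2⟩ := exists_extends M (Localization M) hn
  refine ⟨δ', ⟨⟨n, h1⟩, h2⟩, ?_⟩
  rintro ε ⟨⟨m, hm⟩, he⟩
  exact Extends.unique M hm h1 he h2

/-- The unique extension of a differential operator of `R` to a differential operator of the
localization `M⁻¹R`. -/
noncomputable def extendFun (M : Submonoid R) (δ : diffOps R) : AddMonoid.End (Localization M) :=
  (existsUnique_extends M δ).choose

theorem extendFun_spec (M : Submonoid R) (δ : diffOps R) :
    (∃ n, IsDiffOp n (extendFun M δ)) ∧ Extends (extendFun M δ) (δ : AddMonoid.End R) :=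
  (existsUnique_extends M δ).choose_spec.1

theorem eq_extendFun (M : Submonoid R) (δ : diffOps R) {ε : AddMonoid.End (Localization M)}
    (h : ∃ n, IsDiffOp n ε) (h' : Extends ε (δ : AddMonoid.End R)) : extendFun M δ = ε :=
  (((existsUnique_extends M δ).choose_spec.2) ε ⟨h, h'⟩).symm

/-- Extension of differential operators to the localization, as a ring homomorphism. -/
noncomputable def extendHom (M : Submonoid R) : diffOps R →+* AddMonoid.End (Localization M) where
  toFun := extendFun M
  map_one' := eq_extendFun M _ (diffOps _).one_mem (fun _ => rfl)
  map_zero' := eq_extendFun M _ (diffOps _).zero_mem (fun _ => by simp)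
  map_add' δ ε := eq_extendFun M _
    ((diffOps _).add_mem (extendFun_spec M δ).1 (extendFun_spec M ε).1)
    (fun x => by simp [(extendFun_spec M δ).2 x, (extendFun_spec M ε).2 x])
  map_mul' δ ε := eq_extendFun M _
    ((diffOps _).mul_mem (extendFun_spec M δ).1 (extendFun_spec M ε).1)
    (fun x => by simp [(extendFun_spec M δ).2 _, (extendFun_spec M ε).2 x])

/-- The natural `D_R`-module structure on a localization of `R`. -/
noncomputable instance instModuleLocalization (M : Submonoid R) : Module (diffOps R) (Localization M) :=
  Module.compHom (Localization M) (extendHom M)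

/-- The localization map is `D_R`-linear. -/
theorem smul_algebraMap (M : Submonoid R) (δ : diffOps R) (x : R) :
    δ • (algebraMap R (Localization M) x) = algebraMap R (Localization M) ((δ : AddMonoid.End R) x) :=
  (extendFun_spec M δ).2 x

/-- Operators of order zero act on the localization by multiplication. -/
theorem mulOp_smul (M : Submonoid R) (a : R) (z : Localization M) :
    (⟨mulOp a, 0, a, rfl⟩ : diffOps R) • z = algebraMap R (Localization M) a * z :=
  DFunLike.congr_fun (eq_extendFun M ⟨mulOp a, 0, a, rfl⟩
    (ε := mulOp (algebraMap R (Localization M) a)) ⟨0, _, rfl⟩ (fun x => by simp)) z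

end Extension

/-! Rings of `q`-th powers, `F`-finiteness and the ideals `I_s(g)`. -/

/-- The subring `A^q` of `A` generated by the `q`-th powers of the elements of `A`. If `q` is a
power of a prime `p` with `p = 0` in `A`, it consists exactly of the `q`-th powers
(`mem_powSubring`). -/
def powSubring (A : Type*) [CommRing A] (q : ℕ) : Subring A :=
  Subring.closure (Set.range fun a : A => a ^ q)

theorem mem_powSubring {A : Type*} [CommRing A] (p s : ℕ) [hp : Fact p.Prime] (h0 : (p : A) = 0)
    (x : A) : x ∈ powSubring A (p ^ s) ↔ ∃ y : A, y ^ p ^ s = x := by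
  refine ⟨fun hx => ?_, fun ⟨y, hy⟩ => Subring.subset_closure ⟨y, hy⟩⟩
  rcases subsingleton_or_nontrivial A with _ | _
  · exact ⟨0, Subsingleton.elim _ _⟩
  have : CharP A p := (CharP.charP_iff_prime_eq_zero hp.out).mpr h0
  have hle : powSubring A (p ^ s) ≤ (iterateFrobenius A p s).range := by
    rw [powSubring, Subring.closure_le]
    rintro _ ⟨a, rfl⟩
    exact ⟨a, rfl⟩
  exact hle hx

/-- `R` is `F`-finite: it is a finitely generated module over its subring `R^p`. -/
def IsFFinite (p : ℕ) (R : Type*) [CommRing R] : Prop :=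
  Module.Finite (powSubring R p) R

/-- For a basis `b` of `A` over `A^q`, the ideal of `A` generated by the `q`-th roots of the
coordinates of `g`. -/
def coordIdeal {A : Type*} [CommRing A] {ι : Type*} (q : ℕ)
    (b : Module.Basis ι (powSubring A q) A) (g : A) : Ideal A :=
  Ideal.span {c : A | ∃ i, c ^ q = (b.repr g i : A)}

/-- The ideal `I_s(g)`. On each basic open set `D(r)` for which `R_r` is a (finite) free
`R_r^{p^s}`-module, the ideal of `R_r` generated by the `p^s`-th roots of the coordinates of `g`
in a basis is taken; these local ideals are glued, that is, `I_s(g)` consists of the elements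
of `R` whose image in every such `R_r` lies in the local ideal. -/
def rootIdeal {R : Type*} [CommRing R] (p s : ℕ) (g : R) : Ideal R :=
  ⨅ (r : R) (n : ℕ)
    (b : Module.Basis (Fin n) (powSubring (Localization.Away r) (p ^ s)) (Localization.Away r)),
    (coordIdeal (p ^ s) b (algebraMap R (Localization.Away r) g)).comap
      (algebraMap R (Localization.Away r))

end CharPDMod

/-! Write `q = p ^ s`. By Kunz's theorem `R` is flat over `R^q`, and being finite it is projective,
so it has a finite dual basis `x = ∑ φ i x ^ q * e i` with `q⁻¹`-linear `φ i`. Hence `I_s(g)` is the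
ideal `cartierIdeal q g` of all values `φ g` of `q⁻¹`-linear maps (`rootIdeal_eq_cartierIdeal`),
which needs no choice of local bases. The dual basis also shows that `I_s(h) ⊆ I_s(g)` exactly when
some `R^q`-linear `δ` sends `g` to `h` (`cartierIdeal_le_iff`).

By `F`-finiteness `D_R` is the union over `s` of the rings of `R^q`-linear endomorphisms. Such a `δ`
commutes with `f ^ q`, so `f ^ q * δ(1/f) = δ(f ^ (q - 1))` (`pow_mul_smul_invSelf`). An
`F`-splitting gives `I_{s+k}(g ^ p ^ k) = I_s(g)`, so `I_s(f ^ (p ^ s - 1)) = I_{s+k}(f ^ (p ^ (s+k)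
- p ^ k))`.

If the chain is stable from `s` on, some `δ` sends `f ^ (p ^ (s+k) - 1)` to `f ^ (p ^ (s+k) - p ^
k)`, that is, `1/f` to `1/f ^ p ^ k`; these elements generate `R_f`. Conversely, one operator with
`δ(1/f) = 1/f ^ p` is `p ^ t`-linear for all large `t`, and forces equality in the chain from there
on. -/

namespace CharPDMod

/-! ### Regular local rings and Kunz's theorem in the finite local case -/

section Kunz

open IsLocalRing

/-- Dividing a Noetherian local ring by an element of `𝔪 \ 𝔪²` lowers the number of generators of
the maximal ideal. -/
theorem spanFinrank_maximalIdeal_quotient_lt {R : Type*} [CommRing R] [IsLocalRing R]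
    [IsNoetherianRing R] {x : R} (hx : x ∈ maximalIdeal R) (hx2 : x ∉ maximalIdeal R ^ 2)
    [IsLocalRing (R ⧸ Ideal.span {x})] :
    (maximalIdeal (R ⧸ Ideal.span {x})).spanFinrank + 1 ≤ (maximalIdeal R).spanFinrank := by
  classical
  obtain ⟨s, hs, hspan⟩ := Submodule.FG.exists_span_finset_card_eq_spanFinrank
    (IsNoetherian.noetherian (maximalIdeal R))
  obtain ⟨a, ha⟩ := Submodule.mem_span_finset.mp (hspan ▸ hx : x ∈ Submodule.span R (s : Set R))
  obtain ⟨hsupp, ha⟩ := ha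
  have hsm : ∀ i ∈ s, i ∈ maximalIdeal R := fun i hi => hspan ▸ Submodule.subset_span hi
  -- If all coefficients were in `𝔪`, then `x` would be in `𝔪²`. The generator with unit coefficient
  -- becomes redundant modulo `x`.
  obtain ⟨i, hi, hu⟩ : ∃ i ∈ s, IsUnit (a i) := by
    by_contra! hcon
    refine hx2 ?_
    rw [← ha, pow_two]
    exact Submodule.sum_mem _ fun i hi =>
      Ideal.mul_mem_mul ((mem_maximalIdeal _).mpr (hcon i hi)) (hsm i hi)
  let π := Ideal.Quotient.mk (Ideal.span {x})
  have hle : maximalIdeal (R ⧸ Ideal.span {x}) ≤ Ideal.span (((s.erase i).image π : Finset _) : Set _) := by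
    intro z hz
    obtain ⟨z, rfl⟩ := Ideal.Quotient.mk_surjective z
    have hz' : z ∈ maximalIdeal R := by
      rw [mem_maximalIdeal, mem_nonunits_iff] at hz ⊢
      exact fun h => hz (h.map π)
    have : maximalIdeal R ≤ (Ideal.span (((s.erase i).image π : Finset _) : Set _)).comap π := by
      rw [← hspan]
      have hrest : ∀ j ∈ s, j ≠ i →
          j ∈ (Ideal.span (((s.erase i).image π : Finset _) : Set _)).comap π := fun j hj hji =>
        Ideal.subset_span (by
          simp only [Finset.coe_image]
          exact ⟨j, by simp [hj, hji], rfl⟩)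
      refine Submodule.span_le.mpr fun j hj => ?_
      by_cases hji : j = i
      · subst hji
        have hπ : π (a j * j + ∑ k ∈ s.erase j, a k * k) = 0 := by
          rw [Finset.add_sum_erase s (fun k => a k * k) hi]
          refine Ideal.Quotient.eq_zero_iff_mem.mpr ?_
          have : ∑ k ∈ s, a k * k = x := ha
          rw [this]; exact Ideal.mem_span_singleton_self x
        have hmem : a j * j ∈ (Ideal.span (((s.erase j).image π : Finset _) : Set _)).comap π := by
          rw [Ideal.mem_comap]
          rw [map_add] at hπ
          rw [eq_neg_of_add_eq_zero_left hπ]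
          refine neg_mem ?_
          rw [← Ideal.mem_comap]
          exact Submodule.sum_mem _ fun k hk => Ideal.mul_mem_left _ _
            (hrest k (Finset.mem_of_mem_erase hk) (Finset.ne_of_mem_erase hk))
        exact (Ideal.unit_mul_mem_iff_mem _ hu).mp hmem
      · exact hrest j hj hji
    exact this hz'
  have heq : maximalIdeal (R ⧸ Ideal.span {x}) =
      Ideal.span (((s.erase i).image π : Finset _) : Set _) := by
    refine le_antisymm hle (Ideal.span_le.mpr ?_)
    intro z hz
    simp only [Finset.coe_image] at hz
    obtain ⟨j, hj, rfl⟩ := hz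
    have hj' : j ∈ s := Finset.mem_of_mem_erase (Finset.mem_coe.mp hj)
    have hne : (Ideal.Quotient.mk (Ideal.span {x})) j ∈ nonunits _ := by
      intro h
      have := IsLocalHom.of_surjective π Ideal.Quotient.mk_surjective
      exact hsm j hj' (this.map_nonunit j h)
    exact (mem_maximalIdeal _).mpr hne
  rw [heq, ← hs]
  have h1 := Submodule.spanFinrank_span_le_ncard_of_finite (R := R ⧸ Ideal.span {x})
    (Finset.finite_toSet ((s.erase i).image π))
  rw [Set.ncard_coe_finset] at h1
  have h2 := (Finset.card_image_le (s := s.erase i) (f := π))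
  have h3 := Finset.card_erase_add_one hi
  exact (Nat.add_le_add_right (h1.trans h2) 1).trans h3.le

theorem ringKrullDim_le_quotient_span_singleton_add_one {R : Type*} [CommRing R] [IsLocalRing R]
    [IsNoetherianRing R] {x : R} (hx : x ∈ maximalIdeal R) :
    ringKrullDim R ≤ ringKrullDim (R ⧸ Ideal.span {x}) + 1 := by
  have := ringKrullDim_le_ringKrullDim_quotient_add_encard {x} (R := R)
    (by simpa [ringJacobson_eq_maximalIdeal R] using hx)
  simpa using this

theorem isLocalRing_quotient_span_singleton {R : Type*} [CommRing R] [IsLocalRing R]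
    {x : R} (hx : x ∈ maximalIdeal R) : IsLocalRing (R ⧸ Ideal.span {x}) := by
  have : Nontrivial (R ⧸ Ideal.span {x}) := Ideal.Quotient.nontrivial_iff.mpr fun h =>
    (maximalIdeal.isMaximal R).ne_top (top_le_iff.mp
      (h ▸ (Ideal.span_singleton_le_iff_mem _).mpr hx))
  exact IsLocalRing.of_surjective' _ Ideal.Quotient.mk_surjective

/-- Passing to `R / x` lowers the embedding dimension by at least one and the Krull dimension by at
most one, and the two agree for `R`. -/
theorem isRegularLocalRing_quotient {R : Type*} [CommRing R] [IsRegularLocalRing R] {x : R}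
    (hx : x ∈ maximalIdeal R) (hx2 : x ∉ maximalIdeal R ^ 2) :
    IsRegularLocalRing (R ⧸ Ideal.span {x}) := by
  have := isLocalRing_quotient_span_singleton hx
  refine IsRegularLocalRing.of_spanFinrank_maximalIdeal_le _ ?_
  have h1 := spanFinrank_maximalIdeal_quotient_lt hx hx2
  have h2 := ringKrullDim_le_quotient_span_singleton_add_one hx
  rw [← IsRegularLocalRing.spanFinrank_maximalIdeal] at h2
  have h3 : (((maximalIdeal (R ⧸ Ideal.span {x})).spanFinrank + 1 : ℕ) : WithBot ℕ∞) ≤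
    ringKrullDim (R ⧸ Ideal.span {x}) + 1 := le_trans (by exact_mod_cast h1) h2
  rw [Nat.cast_add, Nat.cast_one] at h3
  generalize ringKrullDim (R ⧸ Ideal.span {x}) = a at h3 ⊢
  induction a with
  | bot => simp at h3
  | coe a =>
    induction a with
    | top => exact le_top
    | coe a =>
      have h4 : (((maximalIdeal (R ⧸ Ideal.span {x})).spanFinrank + 1 : ℕ) : ℕ∞) ≤
        ((a + 1 : ℕ) : ℕ∞) := by exact_mod_cast h3
      exact_mod_cast Nat.le_of_succ_le_succ (by exact_mod_cast h4)

/-- A regular local ring which is not a field has an element of `𝔪 \ 𝔪²` outside all minimal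
primes. -/
theorem exists_mem_maximalIdeal_notMem_sq {R : Type*} [CommRing R] [IsRegularLocalRing R]
    (h : maximalIdeal R ≠ ⊥) : ∃ x ∈ maximalIdeal R, x ∉ maximalIdeal R ^ 2 ∧
      ∀ q ∈ minimalPrimes R, x ∉ q := by
  classical
  have hfin : (minimalPrimes R).Finite := minimalPrimes.finite_of_isNoetherianRing R
  have hsq : ¬ maximalIdeal R ≤ maximalIdeal R ^ 2 := by
    intro hle
    refine h (Submodule.eq_bot_of_le_smul_of_le_jacobson_bot (maximalIdeal R) _
      (IsNoetherian.noetherian _) ?_ (maximalIdeal_le_jacobson _))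
    rwa [smul_eq_mul, ← pow_two]
  have hmin : ∀ q ∈ minimalPrimes R, ¬ maximalIdeal R ≤ q := by
    intro q hq hle
    have hq' := hq.1.1
    have hqm : q = maximalIdeal R := le_antisymm (le_maximalIdeal hq'.ne_top) hle
    have hdim : ringKrullDim R = 0 := by
      rw [← IsLocalRing.maximalIdeal_height_eq_ringKrullDim, ← hqm]
      have : q.height = 0 := Ideal.height_eq_zero_iff.mpr hq
      rw [this]; rfl
    rw [← IsRegularLocalRing.spanFinrank_maximalIdeal] at hdim
    refine h ((Submodule.spanFinrank_eq_zero_iff_eq_bot (IsNoetherian.noetherian _)).mp ?_)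
    exact_mod_cast hdim
  by_contra! hcon
  have hsub : (maximalIdeal R : Set R) ⊆
      ⋃ I ∈ ((insert (maximalIdeal R ^ 2) hfin.toFinset : Finset (Ideal R)) : Set (Ideal R)),
        (id I : Ideal R) := by
    intro x hx
    by_cases hx2 : x ∈ maximalIdeal R ^ 2
    · exact Set.mem_biUnion (x := maximalIdeal R ^ 2) (by simp) hx2
    · obtain ⟨q, hq, hxq⟩ := hcon x hx hx2
      exact Set.mem_biUnion (x := q) (by simp [hq]) hxq
  -- Prime avoidance tolerates two non-prime ideals; `𝔪²` fills both slots.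
  obtain ⟨I, hI, hle⟩ := (Ideal.subset_union_prime (maximalIdeal R ^ 2) (maximalIdeal R ^ 2) (by
    intro i hi hne _
    simp only [Finset.mem_insert, hne, Set.Finite.mem_toFinset, false_or] at hi
    exact hi.1.1)).mp hsub
  simp only [Finset.mem_insert, Set.Finite.mem_toFinset] at hI
  rcases hI with rfl | hI
  · exact hsq hle
  · exact hmin I hI hle

/-- Induction on the embedding dimension makes `(x)` prime. A minimal prime `q ⊆ (x)` does not
contain `x`, so `q = x q`, and Nakayama gives `q = 0`. -/
theorem isDomain_of_isRegularLocalRing (R : Type*) [CommRing R] [IsRegularLocalRing R] :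
    IsDomain R := by
  induction hn : (maximalIdeal R).spanFinrank using Nat.strong_induction_on generalizing R with
  | _ n ih =>
  by_cases h : maximalIdeal R = ⊥
  · exact (isField_iff_maximalIdeal_eq.mpr h).isDomain
  obtain ⟨x, hx, hx2, hmin⟩ := exists_mem_maximalIdeal_notMem_sq h
  have := isRegularLocalRing_quotient hx hx2
  have hlt := spanFinrank_maximalIdeal_quotient_lt hx hx2
  have hdom := ih _ (by omega) (R ⧸ Ideal.span {x}) rfl
  have hprime : (Ideal.span {x}).IsPrime := (Ideal.Quotient.isDomain_iff_prime _).mp hdom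
  obtain ⟨q, hq, hqle⟩ := Ideal.exists_minimalPrimes_le (I := ⊥) (J := Ideal.span {x}) bot_le
  have hqp : q.IsPrime := hq.1.1
  have hxq : x ∉ q := hmin q hq
  have hbot : q = ⊥ := by
    refine Submodule.eq_bot_of_le_smul_of_le_jacobson_bot (maximalIdeal R) _
      (IsNoetherian.noetherian _) ?_ (maximalIdeal_le_jacobson _)
    intro z hz
    obtain ⟨w, rfl⟩ := Ideal.mem_span_singleton'.mp (hqle hz)
    rw [mul_comm, smul_eq_mul]
    exact Ideal.mul_mem_mul hx ((hqp.mem_or_mem hz).resolve_right hxq)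
  subst hbot
  exact IsDomain.of_bot_isPrime R

/-- If `x ∈ 𝔪` becomes a `p`-th power `y ^ p` in a finite `R`-algebra `S` that is a domain, and
`S / y` is free over `R / x`, then `S` is free over `R`. -/
theorem free_of_free_mod_root {R S ι : Type*} [CommRing R] [IsLocalRing R] [IsNoetherianRing R]
    [CommRing S] [IsDomain S] [Algebra R S] [Module.Finite R S] {p : ℕ} {x : R} {y : S}
    (hx : x ∈ maximalIdeal R) (hy : y ≠ 0) (hxy : algebraMap R S x = y ^ p) [Fintype ι] (b : ι → S)
    (hspan : ∀ s, ∃ (c : ι → R) (t : S), s = ∑ j, c j • b j + y * t)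
    (hind : ∀ c : ι → R, y ∣ ∑ j, c j • b j → ∀ j, x ∣ c j) : Module.Free R S := by
  choose C T hCT using hspan
  -- The `y`-adic expansion of `s` to `k` digits, with remainder.
  have h1 : ∀ k s, s = ∑ i ∈ Finset.range k, y ^ i * (∑ j, C (T^[i] s) j • b j) +
      y ^ k * T^[k] s := by
    intro k s
    induction k with
    | zero => simp
    | succ k ih =>
      rw [Finset.sum_range_succ, Function.iterate_succ_apply', add_assoc]
      conv_lhs => rw [ih]
      congr 1
      conv_lhs => rw [hCT (T^[k] s)]
      ring
  -- The bound `k ≤ p` is essential: once `x = y ^ p` divides the lowest digit, that digit is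
  -- divisible by `y ^ k` and can be dropped, after which one factor `y` cancels.
  have h2 : ∀ k ≤ p, ∀ c : ℕ → ι → R, y ^ k ∣ ∑ i ∈ Finset.range k, y ^ i * (∑ j, c i j • b j) →
      ∀ i < k, ∀ j, x ∣ c i j := by
    intro k
    induction k with
    | zero => intro _ _ _ i hi; omega
    | succ k ih =>
      intro hk c hc
      have hsum : ∑ i ∈ Finset.range (k + 1), y ^ i * (∑ j, c i j • b j) =
          y * (∑ i ∈ Finset.range k, y ^ i * (∑ j, c (i + 1) j • b j)) + ∑ j, c 0 j • b j := by
        rw [Finset.sum_range_succ']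
        simp only [pow_succ', mul_assoc, Finset.mul_sum, pow_zero, one_mul]
      rw [hsum] at hc
      have h0 : ∀ j, x ∣ c 0 j := by
        refine hind _ ?_
        exact (dvd_add_right (dvd_mul_right _ _)).mp ((dvd_pow_self y (Nat.succ_ne_zero k)).trans hc)
      have h0' : y ^ (k + 1) ∣ ∑ j, c 0 j • b j := by
        refine Finset.dvd_sum fun j _ => ?_
        obtain ⟨d, hd⟩ := h0 j
        rw [hd, Algebra.smul_def, map_mul, hxy, mul_assoc]
        exact (pow_dvd_pow y hk).trans (dvd_mul_right _ _)
      have h3 := (dvd_add_left h0').mp hc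
      rw [pow_succ', mul_dvd_mul_iff_left hy] at h3
      intro i hi j
      cases i with
      | zero => exact h0 j
      | succ i => exact ih (by omega) _ h3 i (by omega) j
  -- The basis will be `y ^ i * b j` with `i < p`. It spans by Nakayama, because the remainder `y ^
  -- p * t = x • t` lies in `𝔪 S`.
  let g : (Fin p × ι → R) →ₗ[R] S := Fintype.linearCombination R fun a => y ^ (a.1 : ℕ) * b a.2
  have hg : ∀ c : ℕ → ι → R, g (fun a => c a.1 a.2) =
      ∑ i ∈ Finset.range p, y ^ i * (∑ j, c i j • b j) := by
    intro c
    simp only [g, Fintype.linearCombination_apply, Fintype.sum_prod_type, Finset.sum_range,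
      Finset.mul_sum, mul_smul_comm]
  have hsurj : LinearMap.range g = ⊤ := by
    refine top_le_iff.mp (Submodule.le_of_le_smul_of_le_jacobson_bot (I := maximalIdeal R)
      Module.Finite.fg_top (maximalIdeal_le_jacobson _) fun s _ => ?_)
    rw [h1 p s, ← hxy, ← hg (fun i => C (T^[i] s)), ← Algebra.smul_def]
    exact Submodule.add_mem_sup ⟨_, rfl⟩ (Submodule.smul_mem_smul hx trivial)
  have hx0 : algebraMap R S x ≠ 0 := hxy ▸ pow_ne_zero p hy
  -- A relation is `x • d`, and `d` is again a relation since `S` is a domain; so the kernel equals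
  -- `x` times itself.
  have hinj : LinearMap.ker g = ⊥ := by
    refine Submodule.eq_bot_of_le_smul_of_le_jacobson_bot (maximalIdeal R) _
      (IsNoetherian.noetherian _) (fun c hc => ?_) (maximalIdeal_le_jacobson _)
    have hc0 : g c = 0 := hc
    let c' : ℕ → ι → R := fun i j => if h : i < p then c (⟨i, h⟩, j) else 0
    have hcc : (fun a : Fin p × ι => c' a.1 a.2) = c := by
      ext ⟨i, j⟩
      simp [c']
    have hdvd := h2 p le_rfl c' (by rw [← hg c', hcc, hc0]; exact dvd_zero _)
    have hdvd' : ∀ a, x ∣ c a := fun a => by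
      rw [← hcc]; exact hdvd a.1 a.1.2 a.2
    choose d hd using hdvd'
    have hcd : c = x • d := funext hd
    rw [hcd]
    refine Submodule.smul_mem_smul hx ?_
    rw [hcd, map_smul, Algebra.smul_def] at hc0
    exact (mul_eq_zero.mp hc0).resolve_left hx0
  exact Module.Free.of_equiv (LinearEquiv.ofBijective g
    ⟨LinearMap.ker_eq_bot.mp hinj, LinearMap.range_eq_top.mp hsurj⟩)

/-- **Kunz's theorem**, the `F`-finite local case: a regular local ring is free over its subring of
`p`-th powers. The two copies of the ring are kept apart, and related by `e`. -/
theorem free_of_isRegularLocalRing_of_eq_pow {R S : Type*} [CommRing R] [CommRing S]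
    [IsRegularLocalRing R] [Algebra R S] [Module.Finite R S] (e : R ≃+* S) {p : ℕ} (hp : p ≠ 0)
    (he : ∀ r, algebraMap R S r = e r ^ p) : Module.Free R S := by
  induction hn : (maximalIdeal R).spanFinrank using Nat.strong_induction_on generalizing R S with
  | _ n ih =>
  have hRdom := isDomain_of_isRegularLocalRing R
  have hSdom : IsDomain S := e.symm.toMulEquiv.isDomain
  by_cases h : maximalIdeal R = ⊥
  · let := (isField_iff_maximalIdeal_eq.mpr h).toField
    exact Module.Free.of_divisionRing R S
  obtain ⟨x, hx, hx2, -⟩ := exists_mem_maximalIdeal_notMem_sq h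
  have := isRegularLocalRing_quotient hx hx2
  have hlt := spanFinrank_maximalIdeal_quotient_lt hx hx2
  have hx0 : x ≠ 0 := fun h0 => hx2 (h0 ▸ zero_mem _)
  have hy0 : e x ≠ 0 := (map_ne_zero_iff e e.injective).mpr hx0
  -- The quotient upstairs is by the root `e x`, not by `x • 1 = e x ^ p`, so that `R' → S'` is
  -- again a `p`-th power map up to an isomorphism.
  let R' := R ⧸ Ideal.span {x}
  let S' := S ⧸ Ideal.span {e x}
  have hle : Ideal.span {x} ≤ (Ideal.span {e x}).comap (algebraMap R S) := by
    rw [Ideal.span_singleton_le_iff_mem, Ideal.mem_comap, he]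
    exact Ideal.pow_mem_of_mem _ (Ideal.mem_span_singleton_self _) _ (Nat.pos_of_ne_zero hp)
  let : Algebra R' S' := (Ideal.quotientMap (Ideal.span {e x}) (algebraMap R S) hle).toAlgebra
  have hmk : ∀ r : R, algebraMap R' S' (Ideal.Quotient.mk _ r) =
      Ideal.Quotient.mk _ (algebraMap R S r) := fun r => rfl
  have hsmul : ∀ (r : R) (s : S), (Ideal.Quotient.mk _ r : R') • (Ideal.Quotient.mk _ s : S') =
      Ideal.Quotient.mk _ (r • s) := fun r s => by
    rw [Algebra.smul_def, Algebra.smul_def, hmk, map_mul]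
  let e' : R' ≃+* S' := Ideal.quotientEquiv _ _ e (by simp [Ideal.map_span])
  have he' : ∀ r, algebraMap R' S' r = e' r ^ p := by
    intro r
    obtain ⟨r, rfl⟩ := Ideal.Quotient.mk_surjective r
    rw [hmk, he, map_pow]
    rfl
  have : IsScalarTower R R' S' := IsScalarTower.of_algebraMap_eq fun r => rfl
  have : Module.Finite R' S' := Module.Finite.of_restrictScalars_finite R R' S'
  have hfree := ih _ (hn ▸ hlt) (R := R') (S := S') e' he' rfl
  let b := Module.Free.chooseBasis R' S'
  choose β hβ using fun j => Ideal.Quotient.mk_surjective (b j)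
  have hlift : ∀ c : Module.Free.ChooseBasisIndex R' S' → R,
      Ideal.Quotient.mk (Ideal.span {e x}) (∑ j, c j • β j) =
        ∑ j, (Ideal.Quotient.mk (Ideal.span {x}) (c j)) • b j := by
    intro c
    rw [map_sum]
    exact Finset.sum_congr rfl fun j _ => by rw [← hsmul, hβ]
  refine free_of_free_mod_root hx hy0 (he x) β (fun s => ?_) (fun c hc j => ?_)
  · choose c hc using fun j => Ideal.Quotient.mk_surjective (b.repr (Ideal.Quotient.mk _ s) j)
    have : Ideal.Quotient.mk (Ideal.span {e x}) s =
        Ideal.Quotient.mk (Ideal.span {e x}) (∑ j, c j • β j) := by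
      rw [hlift]
      simp only [hc]
      exact (b.sum_repr _).symm
    obtain ⟨t, ht⟩ := Ideal.mem_span_singleton.mp (Ideal.Quotient.eq.mp this)
    exact ⟨c, t, by rw [← ht]; ring⟩
  · have h0 : ∑ j, (Ideal.Quotient.mk (Ideal.span {x}) (c j)) • b j = 0 := by
      rw [← hlift]
      exact Ideal.Quotient.eq_zero_iff_mem.mpr (Ideal.mem_span_singleton.mpr hc)
    have := Fintype.linearIndependent_iff.mp b.linearIndependent _ h0 j
    exact Ideal.mem_span_singleton.mp (Ideal.Quotient.eq_zero_iff_mem.mp this)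

end Kunz

/-! ### Finiteness and flatness of Frobenius on a regular `F`-finite ring -/

section Frobenius

variable {R : Type*} [CommRing R] (p : ℕ) [Fact p.Prime] [CharP R p]

theorem isReduced_of_isRegularRing (R : Type*) [CommRing R] [IsRegularRing R] : IsReduced R := by
  refine isReduced_ofLocalizationMaximal R fun P hP => ?_
  have := isDomain_of_isRegularLocalRing (Localization.AtPrime P)
  infer_instance

theorem frobenius_finite (hF : IsFFinite p R) : (frobenius R p).Finite := by
  have h0 : (p : R) = 0 := CharP.cast_eq_zero R p
  let φ : R →+* powSubring R p := (frobenius R p).codRestrict _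
    fun a => Subring.subset_closure ⟨a, rfl⟩
  have hφ : Function.Surjective φ := fun ⟨x, hx⟩ => by
    obtain ⟨y, hy⟩ := (mem_powSubring p 1 h0 x).mp (by rwa [pow_one])
    rw [pow_one] at hy
    exact ⟨y, Subtype.ext hy⟩
  have h1 : ((powSubring R p).subtype).Finite := by
    have : Module.Finite (powSubring R p) R := hF
    exact RingHom.finite_algebraMap.mpr this
  exact h1.comp (RingHom.Finite.of_surjective φ hφ)

theorem comap_frobenius (P : Ideal R) [P.IsPrime] : P.comap (frobenius R p) = P := by
  ext x
  rw [Ideal.mem_comap, frobenius_def]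
  exact Ideal.IsPrime.pow_mem_iff_mem inferInstance p (Fact.out : p.Prime).pos

/-- Flatness is checked at primes. Frobenius pulls `P` back to `P`, so its localization is the
Frobenius of `R_P`, where the local case applies. -/
theorem frobenius_flat [IsRegularRing R] (hF : IsFFinite p R) : (frobenius R p).Flat := by
  have hp0 : p ≠ 0 := (Fact.out : p.Prime).ne_zero
  refine RingHom.Flat.ofLocalizationPrime _ fun P hP => ?_
  have hcomap := comap_frobenius p P
  -- The pullback of `P` equals `P` only propositionally, so `R₁` and `S₁` are distinct types,
  -- identified by `e`.
  let R₁ := Localization.AtPrime (P.comap (frobenius R p))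
  let S₁ := Localization.AtPrime P
  let φ : R₁ →+* S₁ := Localization.localRingHom (P.comap (frobenius R p)) P (frobenius R p) rfl
  let : Algebra R₁ S₁ := φ.toAlgebra
  have hφ : ∀ r : R, φ (algebraMap R R₁ r) = algebraMap R S₁ (r ^ p) := fun r =>
    Localization.localRingHom_to_map _ _ _ rfl r
  let e : R₁ ≃+* S₁ := IsLocalization.ringEquivOfRingEquiv (M := (P.comap (frobenius R p)).primeCompl)
    (T := P.primeCompl) R₁ S₁ (RingEquiv.refl R) (by simp [hcomap])
  have he : ∀ r, algebraMap R₁ S₁ r = e r ^ p := by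
    intro z
    have : CharP S₁ p := by
      have : Nontrivial S₁ := inferInstance
      refine (CharP.charP_iff_prime_eq_zero Fact.out).mpr ?_
      rw [← map_natCast (algebraMap R S₁), CharP.cast_eq_zero, map_zero]
    have : (algebraMap R₁ S₁ : R₁ →+* S₁) = (frobenius S₁ p).comp (e : R₁ →+* S₁) := by
      refine IsLocalization.ringHom_ext (P.comap (frobenius R p)).primeCompl ?_
      ext r
      have h1 : e (algebraMap R R₁ r) = algebraMap R S₁ r := by simp [e]
      have h2 := hφ r
      simp only [RingHom.comp_apply, RingHom.coe_coe, h1, frobenius_def, ← map_pow]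
      exact h2
    exact DFunLike.congr_fun this z
  have hfin : Module.Finite R₁ S₁ := by
    classical
    have : Module.Finite (powSubring R p) R := hF
    obtain ⟨s, hs⟩ := this.fg_top
    have h1 : ∀ r : R, algebraMap R S₁ r ∈ Submodule.span R₁ (algebraMap R S₁ '' s) := by
      intro r
      have hr : r ∈ Submodule.span (powSubring R p) (s : Set R) := hs ▸ trivial
      induction hr using Submodule.span_induction with
      | mem x hx => exact Submodule.subset_span ⟨x, hx, rfl⟩
      | zero => rw [map_zero]; exact zero_mem _
      | add x y _ _ hx hy => rw [map_add]; exact add_mem hx hy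
      | smul a x _ hx =>
        obtain ⟨y, hy⟩ := (mem_powSubring p 1 (CharP.cast_eq_zero R p) (a : R)).mp
          (by rw [pow_one]; exact a.2)
        rw [pow_one] at hy
        have : algebraMap R S₁ (a • x) = algebraMap R R₁ y • algebraMap R S₁ x := by
          rw [Algebra.smul_def, Algebra.smul_def, map_mul]
          congr 1
          exact ((hφ y).trans (congrArg _ hy)).symm
        rw [this]
        exact Submodule.smul_mem _ _ hx
    refine ⟨⟨s.image (algebraMap R S₁), top_le_iff.mp fun z _ => ?_⟩⟩
    rw [Finset.coe_image]
    obtain ⟨⟨r, t⟩, hz⟩ := IsLocalization.surj P.primeCompl z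
    obtain ⟨u, hu⟩ := (IsLocalization.map_units R₁ (⟨t, fun h =>
      t.2 (hcomap.le h)⟩ : (P.comap (frobenius R p)).primeCompl)).exists_right_inv
    have h2 : algebraMap R S₁ t ^ p * φ u = 1 := by
      rw [← map_pow, ← hφ, ← map_mul, hu, map_one]
    -- Rewrite `r / t` as `r t ^ (p - 1) / t ^ p`: the denominator is now a `p`-th power, hence a
    -- scalar.
    have h3 : z = u • algebraMap R S₁ (r * t ^ (p - 1)) := by
      rw [Algebra.smul_def, map_mul, map_pow]
      change z = φ u * _
      rw [← hz]
      calc z = z * (algebraMap R S₁ t ^ p * φ u) := by rw [h2, mul_one]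
        _ = _ := by
          rw [← pow_sub_one_mul hp0]; ring
    rw [h3]
    exact Submodule.smul_mem _ _ (h1 _)
  have : IsRegularLocalRing R₁ := inferInstance
  have hfree := free_of_isRegularLocalRing_of_eq_pow (R := R₁) (S := S₁) e hp0 he
  change Module.Flat R₁ S₁
  infer_instance

theorem iterateFrobenius_finite (hF : IsFFinite p R) (s : ℕ) : (iterateFrobenius R p s).Finite := by
  induction s with
  | zero => rw [iterateFrobenius_zero]; exact RingHom.Finite.id R
  | succ s ih => rw [iterateFrobenius_add, iterateFrobenius_one]; exact ih.comp (frobenius_finite p hF)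

theorem iterateFrobenius_flat [IsRegularRing R] (hF : IsFFinite p R) (s : ℕ) :
    (iterateFrobenius R p s).Flat := by
  induction s with
  | zero => rw [iterateFrobenius_zero]; exact RingHom.Flat.id R
  | succ s ih => rw [iterateFrobenius_add, iterateFrobenius_one]; exact (frobenius_flat p hF).comp ih

/-- For a reduced ring the iterated Frobenius identifies `R` with `R^{p^s}`. -/
noncomputable def powEquiv (R : Type*) [CommRing R] [CharP R p] [IsReduced R] (s : ℕ) :
    R ≃+* powSubring R (p ^ s) :=
  RingEquiv.ofBijective ((iterateFrobenius R p s).codRestrict (powSubring R (p ^ s))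
      fun a => Subring.subset_closure ⟨a, rfl⟩)
    ⟨fun a b h => iterateFrobenius_inj R p s (Subtype.ext_iff.mp h), fun ⟨x, hx⟩ => by
      obtain ⟨y, hy⟩ := (mem_powSubring p s (CharP.cast_eq_zero R p) x).mp hx
      exact ⟨y, Subtype.ext hy⟩⟩

@[simp] theorem coe_powEquiv [IsReduced R] (s : ℕ) (a : R) :
    (powEquiv p R s a : R) = a ^ p ^ s := rfl

@[simp] theorem powEquiv_symm_pow [IsReduced R] (s : ℕ) (a : powSubring R (p ^ s)) :
    (powEquiv p R s).symm a ^ p ^ s = (a : R) := by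
  rw [← coe_powEquiv, RingEquiv.apply_symm_apply]

theorem finite_powSubring (hF : IsFFinite p R) (s : ℕ) : Module.Finite (powSubring R (p ^ s)) R := by
  let φ : R →+* powSubring R (p ^ s) := (iterateFrobenius R p s).codRestrict _
    fun a => Subring.subset_closure ⟨a, rfl⟩
  have : ((powSubring R (p ^ s)).subtype.comp φ).Finite := iterateFrobenius_finite p hF s
  exact RingHom.finite_algebraMap.mp (RingHom.Finite.of_comp_finite this)

/-- The inclusion of `R^{p^s}` is the inverse of `powEquiv` followed by the iterated Frobenius. -/
theorem flat_powSubring [IsRegularRing R] (hF : IsFFinite p R) (s : ℕ) :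
    Module.Flat (powSubring R (p ^ s)) R := by
  have := isReduced_of_isRegularRing R
  have h : ((powSubring R (p ^ s)).subtype.comp (powEquiv p R s : R →+* _)).Flat :=
    iterateFrobenius_flat p hF s
  have h2 := (RingHom.Flat.of_bijective (f := ((powEquiv p R s).symm : powSubring R (p ^ s) →+* R))
    (powEquiv p R s).symm.bijective).comp h
  rw [← RingHom.flat_algebraMap_iff]
  convert h2
  ext x
  simp
  rfl

theorem isNoetherianRing_powSubring [IsRegularRing R] (s : ℕ) :
    IsNoetherianRing (powSubring R (p ^ s)) :=
  have := isReduced_of_isRegularRing R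
  isNoetherianRing_of_ringEquiv R (powEquiv p R s)

end Frobenius

/-- The additive map `φ` is `q⁻¹`-linear: `φ (a ^ q * x) = a * φ x`. -/
def IsCartier {R : Type*} [CommRing R] (q : ℕ) (φ : R →+ R) : Prop :=
  ∀ a x, φ (a ^ q * x) = a * φ x

/-! ### Dual bases and local freeness over `p^s`-th powers -/

section DualBasis

variable {R : Type*} [CommRing R] (p : ℕ) [Fact p.Prime] [CharP R p]

/-- A regular `F`-finite ring is projective over its ring of `p^s`-th powers, so it has a finite
dual basis, here expressed through `p^{-s}`-linear maps. -/
theorem exists_cartier_dual_basis [IsRegularRing R] (hF : IsFFinite p R) (s : ℕ) :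
    ∃ (n : ℕ) (e : Fin n → R) (φ : Fin n → R →+ R), (∀ i, IsCartier (p ^ s) (φ i)) ∧
      ∀ x, x = ∑ i, φ i x ^ p ^ s * e i := by
  have := isReduced_of_isRegularRing R
  have := finite_powSubring p hF s
  have := flat_powSubring p hF s
  have := isNoetherianRing_powSubring (R := R) p s
  have : Module.FinitePresentation (powSubring R (p ^ s)) R := Module.finitePresentation_of_finite _ _
  have : Module.Projective (powSubring R (p ^ s)) R :=
    Module.freeLocus_eq_univ_iff.mp Module.freeLocus_eq_univ
  obtain ⟨n, f, hf⟩ := Module.Finite.exists_fin' (powSubring R (p ^ s)) R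
  obtain ⟨g, hg⟩ := Module.projective_lifting_property f LinearMap.id hf
  -- Here `g` splits a surjection `f` from a finite free module: `e i` is the image of a unit
  -- vector, `φ i` the `p^s`-th root of the `i`-th coordinate of `g`.
  refine ⟨n, fun i => f (Pi.single i 1), fun i =>
    ((powEquiv p R s).symm : powSubring R (p ^ s) →+ R).comp (LinearMap.proj i ∘ₗ g).toAddMonoidHom,
    fun i a x => ?_, fun x => ?_⟩
  · have h1 : a ^ p ^ s * x = powEquiv p R s a • x := rfl
    change (powEquiv p R s).symm (g (a ^ p ^ s * x) i) = a * (powEquiv p R s).symm (g x i)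
    rw [h1, map_smul, Pi.smul_apply, smul_eq_mul, map_mul, RingEquiv.symm_apply_apply]
  · have h1 : f (g x) = x := DFunLike.congr_fun hg x
    conv_lhs => rw [← h1, LinearMap.pi_apply_eq_sum_univ f (g x)]
    refine Finset.sum_congr rfl fun i _ => ?_
    change _ = ((powEquiv p R s).symm (g x i)) ^ p ^ s * _
    rw [powEquiv_symm_pow]
    rw [Subring.smul_def, smul_eq_mul]
    congr 2
    ext j
    simp [Pi.single_apply, eq_comm]

/-- A basis of `R_r` over `(R^q)_r`, where `q = p ^ s`, gives one over `(R_r)^q`. -/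
theorem exists_basis_localization_away_powSubring [IsRegularRing R] (s : ℕ)
    (r : powSubring R (p ^ s)) {ι : Type*}
    (b : Module.Basis ι (Localization.Away r) (LocalizedModule.Away r R)) :
    Nonempty (Module.Basis ι (powSubring (Localization.Away (r : R)) (p ^ s))
      (Localization.Away (r : R))) := by
  let A := powSubring R (p ^ s)
  let L := Localization.Away (r : R)
  let A' := powSubring L (p ^ s)
  have hqm : ∀ a ∈ A, algebraMap R L a ∈ A' := by
    intro a ha
    obtain ⟨y, rfl⟩ := (mem_powSubring p s (CharP.cast_eq_zero R p) a).mp ha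
    rw [map_pow]
    exact Subring.subset_closure ⟨_, rfl⟩
  let j : A →+* A' := ((algebraMap R L).comp A.subtype).codRestrict A' fun a => hqm a a.2
  let : Algebra A A' := j.toAlgebra
  have : IsScalarTower A A' L := IsScalarTower.of_algebraMap_eq fun a => rfl
  -- Powers commute with localization: `(R_r)^q` is `(R^q)_r` for `r` in `R^q`. The inverse of `r`
  -- is the `q`-th power of the inverse of its root `ρ`.
  have hloc : IsLocalization (Submonoid.powers r) A' := by
    have hunit : IsUnit (algebraMap A A' r) := by
      obtain ⟨ρ, hρ⟩ := (mem_powSubring p s (CharP.cast_eq_zero R p) (r : R)).mp r.2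
      obtain ⟨u, hu⟩ :=
        (IsLocalization.Away.algebraMap_isUnit (S := L) (r : R)).exists_right_inv
      have hu' : algebraMap R L ρ * (algebraMap R L ρ ^ (p ^ s - 1) * u) = 1 := by
        rw [← mul_assoc, mul_pow_sub_one (pow_ne_zero _ (Fact.out : p.Prime).ne_zero), ← map_pow,
          hρ, hu]
      refine .of_mul_eq_one ⟨(algebraMap R L ρ ^ (p ^ s - 1) * u) ^ p ^ s,
        Subring.subset_closure ⟨_, rfl⟩⟩ (Subtype.ext ?_)
      have hρ' : algebraMap R L r = algebraMap R L ρ ^ p ^ s :=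
        (congrArg _ hρ.symm).trans (map_pow _ _ _)
      change algebraMap R L r * (algebraMap R L ρ ^ (p ^ s - 1) * u) ^ p ^ s = 1
      rw [hρ', ← mul_pow, hu', one_pow]
    refine ⟨?_, ?_, ?_⟩
    · rintro ⟨_, k, rfl⟩
      rw [map_pow]
      exact hunit.pow k
    · rintro ⟨z, hz⟩
      have hp0 : (p : L) = 0 := by
        rw [← map_natCast (algebraMap R L), CharP.cast_eq_zero, map_zero]
      obtain ⟨y, rfl⟩ := (mem_powSubring p s hp0 z).mp hz
      obtain ⟨⟨w, ⟨_, k, rfl⟩⟩, hw⟩ := IsLocalization.surj (Submonoid.powers (r : R)) y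
      refine ⟨⟨⟨w ^ p ^ s, Subring.subset_closure ⟨_, rfl⟩⟩, ⟨r ^ (k * p ^ s), _, rfl⟩⟩,
        Subtype.ext ?_⟩
      change y ^ p ^ s * algebraMap R L (((r ^ (k * p ^ s) : A)) : R) = algebraMap R L (w ^ p ^ s)
      rw [map_pow, ← hw, mul_pow, ← map_pow]
      congr 2
      push_cast
      exact pow_mul _ _ _
    · intro a b hab
      obtain ⟨⟨_, k, rfl⟩, hc⟩ := (IsLocalization.eq_iff_exists (Submonoid.powers (r : R)) L).mp
        (congrArg Subtype.val hab : algebraMap R L a = algebraMap R L b)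
      exact ⟨⟨r ^ k, k, rfl⟩, Subtype.ext hc⟩
  have hsub : Algebra.algebraMapSubmonoid R (Submonoid.powers r) = Submonoid.powers (r : R) := by
    rw [Algebra.algebraMapSubmonoid, Submonoid.map_powers]; rfl
  have : IsLocalization (Algebra.algebraMapSubmonoid R (Submonoid.powers r)) L := by
    rw [hsub]; infer_instance
  let f : R →ₗ[A] L := (IsScalarTower.toAlgHom A R L).toLinearMap
  have : IsLocalizedModule (Submonoid.powers r) f := isLocalizedModule_iff_isLocalization.mpr this
  let σ : Localization.Away r ≃ₐ[A] A' :=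
    IsLocalization.algEquiv (Submonoid.powers r) (Localization.Away r) A'
  let : Module (Localization.Away r) L := Module.compHom L (σ : Localization.Away r →+* A')
  have hσ : ∀ (c : Localization.Away r) (x : L), σ c • x = c • x := fun _ _ => rfl
  have : IsScalarTower A (Localization.Away r) L := ⟨fun a c x => by
    rw [← hσ, ← hσ, map_smul, smul_assoc]⟩
  let e := IsLocalizedModule.linearEquiv (Submonoid.powers r)
    (LocalizedModule.mkLinearMap (Submonoid.powers r) R) f
  let e' := e.extendScalarsOfIsLocalization (Submonoid.powers r) (Localization.Away r)
  exact ⟨(b.map e').mapCoeffs (σ : Localization.Away r ≃+* A') hσ⟩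

/-- Locally on `Spec R` the ring is free over its `p^s`-th powers. -/
theorem exists_notMem_basis_localization_away [IsRegularRing R] (hF : IsFFinite p R) (s : ℕ)
    (P : Ideal R) [P.IsPrime] : ∃ r ∉ P, ∃ n : ℕ, Nonempty (Module.Basis (Fin n)
      (powSubring (Localization.Away r) (p ^ s)) (Localization.Away r)) := by
  have := finite_powSubring p hF s
  have := flat_powSubring p hF s
  have := isNoetherianRing_powSubring (R := R) p s
  let A := powSubring R (p ^ s)
  have : Module.FinitePresentation A R := Module.finitePresentation_of_finite _ _
  let Q : Ideal A := P.comap A.subtype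
  -- Finite and flat over a local ring means free; the basis spreads out to some `r ∈ A` outside
  -- `Q`, which as an element of `R` is outside `P`.
  have hfree : Module.Free (Localization.AtPrime Q) (LocalizedModule Q.primeCompl R) :=
    Module.free_of_flat_of_isLocalRing
  let b := Module.Free.chooseBasis (Localization.AtPrime Q) (LocalizedModule Q.primeCompl R)
  obtain ⟨r, hr, b', -⟩ := Module.FinitePresentation.exists_basis_localizedModule_powers
    Q.primeCompl (LocalizedModule.mkLinearMap Q.primeCompl R) (Localization.AtPrime Q)
    (b.reindex (Fintype.equivFin _))
  exact ⟨r, hr, _, exists_basis_localization_away_powSubring p s r b'⟩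

end DualBasis

/-! ### The ideal `I_s(g)` through `p^{-s}`-linear maps -/

section RootIdeal

/-- The ideal of values at `g` of all `q⁻¹`-linear maps. -/
def cartierIdeal {R : Type*} [CommRing R] (q : ℕ) (g : R) : Ideal R where
  carrier := {z | ∃ φ : R →+ R, IsCartier q φ ∧ φ g = z}
  add_mem' := by
    rintro _ _ ⟨φ, hφ, rfl⟩ ⟨ψ, hψ, rfl⟩
    exact ⟨φ + ψ, fun a x => by simp [hφ a x, hψ a x, mul_add], rfl⟩
  zero_mem' := ⟨0, fun a x => by simp, rfl⟩
  smul_mem' := by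
    rintro c _ ⟨φ, hφ, rfl⟩
    exact ⟨(AddMonoidHom.mulLeft c).comp φ, fun a x => by simp [hφ a x, mul_left_comm], rfl⟩

variable {R : Type*} [CommRing R] (p : ℕ) [Fact p.Prime] [CharP R p]

/-- Instead of extending `φ` to `R_r`, the expansion of `g` in the basis is cleared of denominators
and `φ` is applied in `R`. -/
theorem algebraMap_cartier_mem_coordIdeal (s : ℕ) {r : R} {ι : Type*} [Finite ι]
    (b : Module.Basis ι (powSubring (Localization.Away r) (p ^ s)) (Localization.Away r))
    {φ : R →+ R} (hφ : IsCartier (p ^ s) φ) (g : R) :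
    algebraMap R (Localization.Away r) (φ g) ∈
      coordIdeal (p ^ s) b (algebraMap R (Localization.Away r) g) := by
  have := Fintype.ofFinite ι
  let L := Localization.Away r
  have hp0 : (p : L) = 0 := by
    rw [← map_natCast (algebraMap R L), CharP.cast_eq_zero, map_zero]
  choose c hc using fun i => (mem_powSubring p s hp0 _).mp (b.repr (algebraMap R L g) i).2
  have hcmem : ∀ i, c i ∈ coordIdeal (p ^ s) b (algebraMap R L g) := fun i =>
    Ideal.subset_span ⟨i, hc i⟩
  have hg : algebraMap R L g = ∑ i, c i ^ p ^ s * b i := by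
    conv_lhs => rw [← b.sum_repr (algebraMap R L g)]
    exact Finset.sum_congr rfl fun i _ => by rw [hc, Subring.smul_def, smul_eq_mul]
  obtain ⟨⟨_, m, rfl⟩, hγ⟩ := IsLocalization.exist_integer_multiples_of_finite (Submonoid.powers r) c
  obtain ⟨⟨_, m', rfl⟩, hβ⟩ := IsLocalization.exist_integer_multiples_of_finite (Submonoid.powers r) b
  choose γ hγ using hγ
  choose β hβ using hβ
  simp only [Algebra.smul_def] at hγ hβ
  have h1 : algebraMap R L (r ^ (m * p ^ s + m') * g) = algebraMap R L (∑ i, γ i ^ p ^ s * β i) := by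
    rw [map_mul, hg, map_sum, Finset.mul_sum]
    refine Finset.sum_congr rfl fun i _ => ?_
    rw [map_mul, map_pow _ (γ i), hγ, hβ]
    simp only [map_pow]
    ring
  obtain ⟨⟨_, k, rfl⟩, hk⟩ := (IsLocalization.eq_iff_exists (Submonoid.powers r) L).mp h1
  simp only at hk
  set N := k + (m * p ^ s + m')
  have hN : N ≤ N * p ^ s := Nat.le_mul_of_pos_right _ (pow_pos (Fact.out : p.Prime).pos _)
  obtain ⟨M, hM⟩ := Nat.exists_eq_add_of_le hN
  -- The extra factor `r ^ M` turns the denominator `r ^ N` into a `p^s`-th power, which can be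
  -- pulled out of `φ`.
  have h2 : (r ^ N) ^ p ^ s * g = ∑ i, γ i ^ p ^ s * (r ^ (M + k) * β i) := by
    calc (r ^ N) ^ p ^ s * g = r ^ M * (r ^ k * (r ^ (m * p ^ s + m') * g)) := by
          rw [← pow_mul, hM]; simp only [N]; ring
      _ = _ := by
          rw [hk, Finset.mul_sum, Finset.mul_sum]
          exact Finset.sum_congr rfl fun i _ => by ring
  have h3 : r ^ N * φ g = ∑ i, γ i * φ (r ^ (M + k) * β i) := by
    rw [← hφ, h2, map_sum]
    exact Finset.sum_congr rfl fun i _ => hφ _ _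
  have h4 : algebraMap R L r ^ N * algebraMap R L (φ g) ∈
      coordIdeal (p ^ s) b (algebraMap R L g) := by
    rw [← map_pow, ← map_mul, h3, map_sum]
    refine Submodule.sum_mem _ fun i _ => ?_
    rw [map_mul, hγ]
    exact Ideal.mul_mem_right _ _ (Ideal.mul_mem_left _ _ (hcmem i))
  exact (Ideal.unit_mul_mem_iff_mem _
    ((IsLocalization.Away.algebraMap_isUnit (S := L) r).pow N)).mp h4

/-- Expanding `g` in the dual basis, its `i`-th coordinate is the `p^s`-th power of `∑ j, φ j g * d
j`, where `d j ^ p ^ s` is the `i`-th coordinate of `e j`. Roots are unique because `R_r` is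
reduced. -/
theorem coordIdeal_le_map_cartierIdeal [IsRegularRing R] (hF : IsFFinite p R) (s : ℕ) {r : R}
    {ι : Type*} (b : Module.Basis ι (powSubring (Localization.Away r) (p ^ s)) (Localization.Away r))
    (g : R) : coordIdeal (p ^ s) b (algebraMap R (Localization.Away r) g) ≤
      (cartierIdeal (p ^ s) g).map (algebraMap R (Localization.Away r)) := by
  obtain ⟨n, e, φ, hφ, he⟩ := exists_cartier_dual_basis p hF s
  let L := Localization.Away r
  refine Ideal.span_le.mpr ?_
  rintro c ⟨i, hc⟩
  rcases subsingleton_or_nontrivial L with _ | _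
  · rw [Subsingleton.elim c 0]; exact zero_mem _
  have hp0 : (p : L) = 0 := by
    rw [← map_natCast (algebraMap R L), CharP.cast_eq_zero, map_zero]
  have : CharP L p := (CharP.charP_iff_prime_eq_zero Fact.out).mpr hp0
  have := isReduced_of_isRegularRing R
  have : IsReduced L := inferInstanceAs (IsReduced (Localization (Submonoid.powers r)))
  choose d hd using fun j =>
    (mem_powSubring p s hp0 _).mp (b.repr (algebraMap R L (e j)) i).2
  have h1 : algebraMap R L g = ∑ j, (powEquiv p L s (algebraMap R L (φ j g))) • algebraMap R L (e j) := by
    conv_lhs => rw [he g, map_sum]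
    refine Finset.sum_congr rfl fun j _ => ?_
    rw [map_mul, map_pow, Subring.smul_def, smul_eq_mul, coe_powEquiv]
  have h2 : c ^ p ^ s = (∑ j, algebraMap R L (φ j g) * d j) ^ p ^ s := by
    rw [hc, h1, map_sum, Finsupp.finsetSum_apply, sum_pow_char_pow]
    simp only [map_smul, Finsupp.smul_apply, smul_eq_mul]
    push_cast
    simp only [coe_powEquiv, mul_pow, hd]
  rw [iterateFrobenius_inj L p s h2]
  exact Submodule.sum_mem _ fun j _ =>
    Ideal.mul_mem_right _ _ (Ideal.mem_map_of_mem _ ⟨φ j, hφ j, rfl⟩)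

theorem rootIdeal_eq_cartierIdeal [IsRegularRing R] (hF : IsFFinite p R) (s : ℕ) (g : R) :
    rootIdeal p s g = cartierIdeal (p ^ s) g := by
  refine le_antisymm (fun x hx => ?_) ?_
  · by_contra hcon
    -- The colon ideal of multipliers taking `x` into `cartierIdeal`; near any maximal ideal
    -- containing it, a power of some `r` outside belongs to it.
    let K : Ideal R := Submodule.comap (LinearMap.mulRight R x) (cartierIdeal (p ^ s) g)
    have hK : K ≠ ⊤ := fun h => hcon (by
      have : (1 : R) ∈ K := h ▸ trivial
      simpa [K] using this)
    obtain ⟨P, hP, hKP⟩ := Ideal.exists_le_maximal K hK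
    obtain ⟨r, hr, n, ⟨b⟩⟩ := exists_notMem_basis_localization_away p hF s P
    simp only [rootIdeal, Ideal.mem_iInf, Ideal.mem_comap] at hx
    have h1 := coordIdeal_le_map_cartierIdeal p hF s b g (hx r n b)
    obtain ⟨_, ⟨k, rfl⟩, hk⟩ :=
      (IsLocalization.algebraMap_mem_map_algebraMap_iff (Submonoid.powers r) _ _ _).mp h1
    exact hr (hP.isPrime.mem_of_pow_mem k (hKP hk))
  · rintro _ ⟨φ, hφ, rfl⟩
    simp only [rootIdeal, Ideal.mem_iInf, Ideal.mem_comap]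
    exact fun r n b => algebraMap_cartier_mem_coordIdeal p s b hφ g

end RootIdeal

/-- An additive endomorphism of `R` which is linear over the `q`-th powers. -/
def IsPowLinear {R : Type*} [CommRing R] (q : ℕ) (δ : AddMonoid.End R) : Prop :=
  ∀ a x, δ (a ^ q * x) = a ^ q * δ x

/-! ### Differential operators are the maps linear over some `p^s`-th powers -/

section Ad

variable {R : Type*} [CommRing R]

/-- The operator `δ ↦ comm δ r`. -/
def adOp (r : R) : AddMonoid.End (AddMonoid.End R) :=
  AddMonoidHom.mulRight (mulOp r) - AddMonoidHom.mulLeft (mulOp r)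

theorem adOp_apply (r : R) (δ : AddMonoid.End R) : adOp r δ = comm δ r := rfl

theorem adOp_commute (r s : R) : Commute (adOp r) (adOp s) := by
  ext δ x
  change comm (comm δ s) r x = comm (comm δ r) s x
  simp [mul_left_comm]
  ring

theorem adOp_pow_apply_eq_zero {n : ℕ} {δ : AddMonoid.End R} (h : IsDiffOp n δ) (r : R) :
    (adOp r ^ (n + 1)) δ = 0 := by
  induction n generalizing δ with
  | zero =>
    obtain ⟨a, rfl⟩ := h
    ext x
    simp [adOp_apply]
    ring
  | succ n ih =>
    rw [pow_succ]
    exact ih (h r)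

/-- `adOp r` is a difference of two commuting operators, composition with `mulOp r` on either side,
in a ring of characteristic `p`; so powers `p ^ s` distribute over it. -/
theorem adOp_pow_char_pow (p : ℕ) [Fact p.Prime] [CharP R p] (s : ℕ) (r : R) :
    adOp r ^ p ^ s = adOp (r ^ p ^ s) := by
  have : Nontrivial R := CharP.nontrivial_of_char_ne_one (Fact.out : p.Prime).ne_one
  have : Nontrivial (AddMonoid.End (AddMonoid.End R)) := ⟨⟨1, 0, fun h => one_ne_zero
    (DFunLike.congr_fun (DFunLike.congr_fun h (1 : AddMonoid.End R)) (1 : R))⟩⟩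
  have : CharP (AddMonoid.End (AddMonoid.End R)) p := by
    refine (CharP.charP_iff_prime_eq_zero Fact.out).mpr ?_
    ext δ x
    rw [← nsmul_one]
    change p • δ x = 0
    rw [nsmul_eq_mul, CharP.cast_eq_zero, zero_mul]
  let ρ : R → AddMonoid.End (AddMonoid.End R) := fun r => AddMonoidHom.mulRight (mulOp r)
  let l : R → AddMonoid.End (AddMonoid.End R) := fun r => AddMonoidHom.mulLeft (mulOp r)
  have hρ : ∀ r δ x, ρ r δ x = δ (r * x) := fun _ _ _ => rfl
  have hl : ∀ r δ x, l r δ x = r * δ x := fun _ _ _ => rfl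
  have hc : Commute (ρ r) (l r) := by
    ext δ x; rfl
  have h1 : ∀ n : ℕ, ρ r ^ n = ρ (r ^ n) := by
    intro n
    induction n with
    | zero => ext δ x; rw [hρ, pow_zero, pow_zero, one_mul]; rfl
    | succ n ih =>
      rw [pow_succ, ih]
      ext δ x
      change δ (r * (r ^ n * x)) = δ (r ^ (n + 1) * x)
      ring_nf
  have h2 : ∀ n : ℕ, l r ^ n = l (r ^ n) := by
    intro n
    induction n with
    | zero => ext δ x; rw [hl, pow_zero, pow_zero, one_mul]; rfl
    | succ n ih =>
      rw [pow_succ, ih]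
      ext δ x
      change r ^ n * (r * δ x) = r ^ (n + 1) * δ x
      ring
  change (ρ r - l r) ^ p ^ s = ρ (r ^ p ^ s) - l (r ^ p ^ s)
  rw [sub_pow_char_pow_of_commute _ _ hc, h1, h2]

/-- A differential operator of order `< p^s` is linear over the `p^s`-th powers. -/
theorem IsDiffOp.isPowLinear (p : ℕ) [Fact p.Prime] [CharP R p] {n s : ℕ} (hn : n < p ^ s)
    {δ : AddMonoid.End R} (h : IsDiffOp n δ) : IsPowLinear (p ^ s) δ := by
  intro a x
  have h1 : comm δ (a ^ p ^ s) = 0 := by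
    rw [← adOp_apply, ← adOp_pow_char_pow p, ← Nat.sub_add_cancel (Nat.succ_le_of_lt hn), pow_add]
    change (adOp a ^ _) ((adOp a ^ (n + 1)) δ) = 0
    rw [adOp_pow_apply_eq_zero h, map_zero]
  have h2 := DFunLike.congr_fun h1 x
  rw [comm_apply] at h2
  exact sub_eq_zero.mp h2

/-- An endomorphism linear over a subring `A`, nilpotent under the commutators with a finite set of
generators of the `A`-module `R`, is a differential operator. -/
theorem isDiffOp_of_adOp_pow_eq_zero (A : Subring R) {ι : Type*} [Fintype ι] (X : ι → R)
    (hX : Submodule.span A (Set.range X) = ⊤) (N : ℕ) {δ : AddMonoid.End R}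
    (hδ : ∀ a ∈ A, ∀ x, δ (a * x) = a * δ x) (k : ι → ℕ) (hk : ∑ i, k i ≤ N)
    (h : ∀ i, (adOp (X i) ^ k i) δ = 0) : IsDiffOp (N + 1) δ := by
  classical
  -- The commutator with `X i` lowers `k i` by one and, as the `adOp` commute, preserves the other
  -- vanishing conditions. By `A`-linearity of `δ`, commutators with the generators suffice. If some
  -- `k i = 0`, then `δ = 0`.
  induction N generalizing δ k with
  | zero =>
    refine succ_of_comm_generators hX hδ fun i => ?_
    have hi : k i = 0 := by
      have := Finset.single_le_sum (f := k) (fun _ _ => Nat.zero_le _) (Finset.mem_univ i)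
      omega
    have h0 := h i
    rw [hi, pow_zero] at h0
    have h0' : δ = 0 := h0
    rw [← adOp_apply, h0', map_zero]
    exact IsDiffOp.zero _
  | succ N ih =>
    refine succ_of_comm_generators hX hδ fun i => ?_
    by_cases hi : k i = 0
    · have h0 := h i
      rw [hi, pow_zero] at h0
      have h0' : δ = 0 := h0
      rw [← adOp_apply, h0', map_zero]
      exact IsDiffOp.zero _
    · refine ih (δ := comm δ (X i)) (fun a ha x => ?_) (Function.update k i (k i - 1)) ?_ fun j => ?_
      · rw [comm_apply, comm_apply, mul_left_comm, hδ a ha, hδ a ha]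
        ring
      · rw [Finset.sum_update_of_mem (Finset.mem_univ i)]
        have h1 := Finset.add_sum_erase Finset.univ k (Finset.mem_univ i)
        rw [← Finset.sdiff_singleton_eq_erase] at h1
        omega
      · by_cases hj : j = i
        · subst hj
          rw [Function.update_self, ← adOp_apply]
          change (adOp (X j) ^ (k j - 1) * adOp (X j)) δ = 0
          rw [pow_sub_one_mul hi, h]
        · rw [Function.update_of_ne hj, ← adOp_apply]
          change (adOp (X j) ^ k j * adOp (X i)) δ = 0
          rw [((adOp_commute (X j) (X i)).pow_left (k j)).eq]
          change adOp (X i) ((adOp (X j) ^ k j) δ) = 0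
          rw [h, map_zero]
where
  succ_of_comm_generators {A : Subring R} {ι : Type _} {X : ι → R} (hX : Submodule.span A (Set.range X) = ⊤)
      {n : ℕ} {δ : AddMonoid.End R} (hδ : ∀ a ∈ A, ∀ x, δ (a * x) = a * δ x)
      (h : ∀ i, IsDiffOp n (comm δ (X i))) : IsDiffOp (n + 1) δ := by
    intro r
    have hr : r ∈ Submodule.span A (Set.range X) := hX ▸ trivial
    induction hr using Submodule.span_induction with
    | mem x hx => obtain ⟨i, rfl⟩ := hx; exact h i
    | zero =>
      have : comm δ 0 = 0 := by ext x; simp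
      rw [this]; exact IsDiffOp.zero _
    | add x y _ _ hx hy =>
      have : comm δ (x + y) = comm δ x + comm δ y := by ext z; simp [add_mul]; ring
      rw [this]; exact hx.add hy
    | smul a x _ hx =>
      have : comm δ (a • x) = mulOp (a : R) * comm δ x := by
        ext z
        simp only [comm_apply, end_mul_apply, mulOp_apply, Subring.smul_def, smul_eq_mul]
        rw [mul_assoc, hδ a a.2]
        ring
      rw [this]; exact hx.mulOp_left _

/-- For each generator, `adOp (X i) ^ p ^ s = adOp (X i ^ p ^ s)` kills `δ`. This is the converse of
`IsDiffOp.isPowLinear`. -/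
theorem IsPowLinear.exists_isDiffOp (p : ℕ) [Fact p.Prime] [CharP R p] (hF : IsFFinite p R) {s : ℕ}
    {δ : AddMonoid.End R} (h : IsPowLinear (p ^ s) δ) : ∃ n, IsDiffOp n δ := by
  have := finite_powSubring p hF s
  obtain ⟨m, X, hX⟩ := Module.Finite.exists_fin (R := powSubring R (p ^ s)) (M := R)
  refine ⟨_, isDiffOp_of_adOp_pow_eq_zero _ X hX _ (fun a ha x => ?_) (fun _ => p ^ s) le_rfl
    fun i => ?_⟩
  · obtain ⟨y, rfl⟩ := (mem_powSubring p s (CharP.cast_eq_zero R p) a).mp ha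
    exact h y x
  · rw [adOp_pow_char_pow p, adOp_apply]
    ext x
    rw [comm_apply, h, sub_self, end_zero_apply]

end Ad

/-! ### Comparison of the ideals for varying `s` and `g` -/

section CartierIdeal

variable {R : Type*} [CommRing R] (p : ℕ) [Fact p.Prime] [CharP R p]

/-- `h` lies in the orbit of `g` under the `p^s`-linear operators if and only if `I_s(h) ⊆ I_s(g)`. -/
theorem cartierIdeal_le_iff [IsRegularRing R] (hF : IsFFinite p R) (s : ℕ) (g h : R) :
    cartierIdeal (p ^ s) h ≤ cartierIdeal (p ^ s) g ↔
      ∃ δ : AddMonoid.End R, IsPowLinear (p ^ s) δ ∧ δ g = h := by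
  constructor
  · intro hle
    obtain ⟨n, e, φ, hφ, he⟩ := exists_cartier_dual_basis p hF s
    -- Replace each dual coordinate `φ i` by a map whose value at `g` is `φ i h`; reassembling then
    -- sends `g` to `h`.
    choose ψ hψ hψg using fun i => hle ⟨φ i, hφ i, rfl⟩
    let δ : AddMonoid.End R := AddMonoidHom.mk' (fun x => ∑ i, ψ i x ^ p ^ s * e i) fun x y => by
      simp only [map_add, add_pow_char_pow, add_mul, Finset.sum_add_distrib]
    have hδ : ∀ x, δ x = ∑ i, ψ i x ^ p ^ s * e i := fun _ => rfl
    refine ⟨δ, fun a x => ?_, ?_⟩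
    · rw [hδ, hδ, Finset.mul_sum]
      refine Finset.sum_congr rfl fun i _ => ?_
      rw [hψ, mul_pow, mul_assoc]
    · rw [hδ]
      conv_rhs => rw [he h]
      exact Finset.sum_congr rfl fun i _ => by rw [hψg]
  · rintro ⟨δ, hδ, rfl⟩ _ ⟨φ, hφ, rfl⟩
    exact ⟨φ.comp δ, fun a x => (congrArg φ (hδ a x)).trans (hφ a _), rfl⟩

/-- Precomposing a `p^{-(s+k)}`-linear map with `x ↦ x ^ p ^ k * h` makes it `p^{-s}`-linear. With
`k = 1` and `h = f ^ (p - 1)` this gives the descending chain. -/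
theorem cartierIdeal_pow_mul_le (s k : ℕ) (g h : R) :
    cartierIdeal (p ^ (s + k)) (g ^ p ^ k * h) ≤ cartierIdeal (p ^ s) g := by
  rintro _ ⟨φ, hφ, rfl⟩
  refine ⟨φ.comp ((AddMonoidHom.mulRight h).comp (iterateFrobenius R p k).toAddMonoidHom),
    fun a x => ?_, rfl⟩
  change φ ((a ^ p ^ s * x) ^ p ^ k * h) = a * φ (x ^ p ^ k * h)
  rw [← hφ, mul_pow, ← pow_mul, ← pow_add, mul_assoc]

/-- Regular `F`-finite rings are `F`-split. -/
theorem exists_isCartier_map_one [IsRegularRing R] (hF : IsFFinite p R) (k : ℕ) :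
    ∃ θ : R →+ R, IsCartier (p ^ k) θ ∧ θ 1 = 1 := by
  have hp : p ^ k ≠ 0 := pow_ne_zero _ (Fact.out : p.Prime).ne_zero
  suffices h : cartierIdeal (p ^ k) (1 : R) = ⊤ by
    exact (h ▸ trivial : (1 : R) ∈ cartierIdeal (p ^ k) (1 : R))
  by_contra hcon
  obtain ⟨P, hP, hle⟩ := Ideal.exists_le_maximal _ hcon
  obtain ⟨n, e, φ, hφ, he⟩ := exists_cartier_dual_basis p hF k
  -- If every value at `1` were in `P`, the dual basis expansion of `1` would put `1` in `P`.
  refine hP.ne_top ((Ideal.eq_top_iff_one _).mpr ?_)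
  rw [he 1]
  exact Submodule.sum_mem _ fun i _ => Ideal.mul_mem_right _ _
    (Ideal.pow_mem_of_mem _ (hle ⟨φ i, hφ i, rfl⟩) _ (Nat.pos_of_ne_zero hp))

/-- For the nontrivial inclusion, precompose with a splitting `θ`, which satisfies `θ (g ^ p ^ k) =
g`. -/
theorem cartierIdeal_pow_eq [IsRegularRing R] (hF : IsFFinite p R) (s k : ℕ) (g : R) :
    cartierIdeal (p ^ (s + k)) (g ^ p ^ k) = cartierIdeal (p ^ s) g := by
  refine le_antisymm (by simpa using cartierIdeal_pow_mul_le p s k g 1) ?_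
  rintro _ ⟨ψ, hψ, rfl⟩
  obtain ⟨θ, hθ, hθ1⟩ := exists_isCartier_map_one p hF k
  refine ⟨ψ.comp θ, fun a x => ?_, ?_⟩
  · simp only [AddMonoidHom.comp_apply]
    rw [pow_add, pow_mul, hθ, hψ]
  · have := hθ g 1
    rw [mul_one, hθ1, mul_one] at this
    rw [AddMonoidHom.comp_apply, this]

/-- An equality in `R_f` holds in `R` only after multiplying by a power of `f`, possibly a zero
divisor. In the domain `R_P` either `f = 0`, so `f ^ n = 0` as `n ≠ 0`, or `g = f ^ n`. -/
theorem cartierIdeal_le_of_pow_mul_eq [IsRegularRing R] {q N n : ℕ} (hq : q ≠ 0) (hn : n ≠ 0)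
    {f g : R} (h : f ^ N * g = f ^ N * f ^ n) :
    cartierIdeal q (f ^ n) ≤ cartierIdeal q g := by
  rintro _ ⟨φ, hφ, rfl⟩
  by_contra hcon
  let K : Ideal R := Submodule.comap (LinearMap.mulRight R (φ (f ^ n))) (cartierIdeal q g)
  have hK : K ≠ ⊤ := fun h => hcon (by
    have : (1 : R) ∈ K := h ▸ trivial
    simpa [K] using this)
  obtain ⟨P, hP, hKP⟩ := Ideal.exists_le_maximal K hK
  have := isDomain_of_isRegularLocalRing (Localization.AtPrime P)
  have h0 : algebraMap R (Localization.AtPrime P) f ^ N *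
      algebraMap R (Localization.AtPrime P) (g - f ^ n) = 0 := by
    rw [← map_pow, ← map_mul, mul_sub, h, sub_self, map_zero]
  have hzero : ∀ {z : R}, algebraMap R (Localization.AtPrime P) z = 0 → ∃ a ∉ P, a * z = 0 := by
    intro z hz
    obtain ⟨a, ha⟩ := (IsLocalization.map_eq_zero_iff P.primeCompl _ z).mp hz
    exact ⟨a, a.2, ha⟩
  have hpow : ∀ a : R, a ^ q = a ^ (q - 1) * a := fun a => (pow_sub_one_mul hq a).symm
  suffices H : ∃ a ∉ P, a * φ (f ^ n) ∈ cartierIdeal q g by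
    obtain ⟨a, ha, haK⟩ := H
    exact ha (hKP haK)
  rcases mul_eq_zero.mp h0 with h1 | h1
  · obtain ⟨a, ha, haf⟩ := hzero (eq_zero_of_pow_eq_zero h1)
    refine ⟨a, ha, ?_⟩
    rw [← hφ, hpow, ← pow_sub_one_mul hn f, mul_mul_mul_comm, haf, mul_zero, map_zero]
    exact zero_mem _
  · obtain ⟨a, ha, hau⟩ := hzero h1
    refine ⟨a, ha, ?_⟩
    have : a ^ q * f ^ n = a ^ q * g := by
      rw [hpow]; linear_combination (-a ^ (q - 1)) * hau
    rw [← hφ, this, hφ]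
    exact Ideal.mul_mem_left _ _ ⟨φ, hφ, rfl⟩

end CartierIdeal

/-! ### Action of differential operators on `1/f`, and the main theorem -/

section Localization

variable {R : Type*} [CommRing R]

open IsLocalization.Away in
/-- The action of a `q`-linear differential operator on `1 / f`. -/
theorem pow_mul_smul_invSelf {q : ℕ} (hq : q ≠ 0) (f : R) (δ : diffOps R)
    (hδ : IsPowLinear q (δ : AddMonoid.End R)) :
    algebraMap R (Localization.Away f) f ^ q * (δ • (invSelf f : Localization.Away f)) =
      algebraMap R (Localization.Away f) ((δ : AddMonoid.End R) (f ^ (q - 1))) := by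
  let m : diffOps R := ⟨mulOp (f ^ q), 0, _, rfl⟩
  have hcomm : m * δ = δ * m := Subtype.ext (by
    ext x
    exact (hδ f x).symm)
  have h1 : m • δ • (invSelf f : Localization.Away f) = δ • m • invSelf f := by
    rw [← mul_smul, hcomm, mul_smul]
  rw [← smul_algebraMap, ← map_pow, ← mulOp_smul (Submonoid.powers f) (f ^ q), h1, mulOp_smul]
  congr 1
  rw [← pow_sub_one_mul hq f, map_mul, mul_assoc, mul_invSelf, mul_one]

end Localization

end CharPDMod

open CharPDMod in
theorem corollary3p6 {R : Type*} [CommRing R] [IsRegularRing R] (p : ℕ) [Fact p.Prime]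
    [CharP R p] (hF : CharPDMod.IsFFinite p R) (f : R) :
    (∀ s : ℕ, 1 ≤ s → CharPDMod.rootIdeal p (s + 1) (f ^ (p ^ (s + 1) - 1)) ≤
        CharPDMod.rootIdeal p s (f ^ (p ^ s - 1))) ∧
    ((∃ s : ℕ, 1 ≤ s ∧ ∀ t : ℕ, s ≤ t →
        CharPDMod.rootIdeal p t (f ^ (p ^ t - 1)) = CharPDMod.rootIdeal p s (f ^ (p ^ s - 1))) ↔
      Submodule.span (CharPDMod.diffOps R)
        {(IsLocalization.Away.invSelf f : Localization.Away f)} = ⊤) := by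
  have hp : p.Prime := Fact.out
  have hpow : ∀ s k : ℕ, f ^ (p ^ (s + k) - p ^ k) = (f ^ (p ^ s - 1)) ^ p ^ k := fun s k => by
    rw [← pow_mul, Nat.sub_mul, one_mul, ← pow_add]
  have hlek : ∀ s k : ℕ, p ^ k ≤ p ^ (s + k) := fun s k =>
    Nat.pow_le_pow_right hp.pos (Nat.le_add_left _ _)
  simp only [rootIdeal_eq_cartierIdeal p hF]
  have hchain : ∀ s : ℕ, cartierIdeal (p ^ (s + 1)) (f ^ (p ^ (s + 1) - 1)) ≤
      cartierIdeal (p ^ s) (f ^ (p ^ s - 1)) := fun s => by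
    have h1 : f ^ (p ^ (s + 1) - 1) = (f ^ (p ^ s - 1)) ^ p ^ 1 * f ^ (p ^ 1 - 1) := by
      rw [← hpow, ← pow_add]
      congr 1
      have := hlek s 1
      have := hp.pos
      simp only [pow_one] at *
      omega
    rw [h1]
    exact cartierIdeal_pow_mul_le p s 1 _ _
  refine ⟨fun s _ => hchain s, ?_, ?_⟩
  · rintro ⟨s, -, hs⟩
    have hz : ∀ k, ∃ z ∈ Submodule.span (diffOps R)
        {(IsLocalization.Away.invSelf f : Localization.Away f)},
        algebraMap R (Localization.Away f) f ^ p ^ k * z = 1 := by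
      intro k
      -- The left side is `I_s(f ^ (p ^ s - 1))`, so this is stability; the resulting `δ` sends
      -- `1/f` to `1/f ^ p ^ k`.
      have hle : cartierIdeal (p ^ (s + k)) (f ^ (p ^ (s + k) - p ^ k)) ≤
          cartierIdeal (p ^ (s + k)) (f ^ (p ^ (s + k) - 1)) := by
        rw [hpow, cartierIdeal_pow_eq p hF, hs (s + k) (Nat.le_add_right _ _)]
      obtain ⟨δ, hδ, hδf⟩ := (cartierIdeal_le_iff p hF (s + k) _ _).mp hle
      let D : diffOps R := ⟨δ, hδ.exists_isDiffOp p hF⟩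
      refine ⟨D • IsLocalization.Away.invSelf f,
        Submodule.smul_mem _ _ (Submodule.mem_span_singleton_self _), ?_⟩
      have h1 := pow_mul_smul_invSelf (pow_ne_zero _ hp.ne_zero) f D hδ
      change _ = algebraMap R _ (δ _) at h1
      rw [hδf, ← Nat.sub_add_cancel (hlek s k), pow_add, Nat.add_sub_cancel, map_pow, mul_assoc] at h1
      exact ((IsLocalization.Away.algebraMap_isUnit f).pow _).mul_left_cancel
        (h1.trans (mul_one _).symm)
    refine eq_top_iff.mpr fun w _ => ?_
    obtain ⟨⟨a, ⟨_, n, rfl⟩⟩, hw⟩ := IsLocalization.surj (Submonoid.powers f) w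
    obtain ⟨z, hzmem, hz⟩ := hz n
    obtain ⟨m, hm⟩ := Nat.exists_eq_add_of_le (Nat.lt_pow_self (n := n) hp.one_lt).le
    have h1 : w = (⟨mulOp (a * f ^ m), 0, _, rfl⟩ : diffOps R) • z := by
      rw [mulOp_smul, map_mul, ← hw, map_pow, map_pow]
      rw [hm, pow_add] at hz
      linear_combination (-w) * hz
    rw [h1]
    exact Submodule.smul_mem _ _ hzmem
  · intro htop
    obtain ⟨D, hD⟩ := Submodule.mem_span_singleton.mp (htop ▸ trivial :
      (IsLocalization.Away.invSelf f : Localization.Away f) ^ p ∈ Submodule.span (diffOps R)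
        {(IsLocalization.Away.invSelf f : Localization.Away f)})
    obtain ⟨n, hn⟩ := D.2
    have hinv : algebraMap R (Localization.Away f) f ^ p *
        (IsLocalization.Away.invSelf f : Localization.Away f) ^ p = 1 := by
      rw [← mul_pow, IsLocalization.Away.mul_invSelf, one_pow]
    -- From `t ≥ n + 1` on, `p ^ (t + 1)` exceeds both the order `n` of `D` and `p`.
    refine ⟨n + 1, Nat.le_add_left _ _, fun t ht => ?_⟩
    induction t, ht using Nat.le_induction with
    | base => rfl
    | succ t ht ih =>
      refine le_antisymm ((hchain t).trans ih.le) (ih.symm.le.trans ?_)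
      have hlt : n < p ^ (t + 1) := (Nat.lt_pow_self hp.one_lt).trans_le
        (Nat.pow_le_pow_right hp.pos (by omega))
      have hlin := hn.isPowLinear p hlt
      have hle := hlek t 1
      have hlt' : p < p ^ (t + 1) := by
        conv_lhs => rw [← pow_one p]
        exact Nat.pow_lt_pow_right hp.one_lt (by omega)
      have h1 := pow_mul_smul_invSelf (pow_ne_zero _ hp.ne_zero) f D hlin
      rw [hD, ← Nat.sub_add_cancel hlt'.le, pow_add, mul_assoc, hinv, mul_one,
        Nat.sub_add_cancel hlt'.le, ← map_pow] at h1
      -- With `q = p ^ (t + 1)`, `D (f ^ (q - 1))` and `f ^ (q - p)` agree in `R_f`, hence in `R` up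
      -- to a power of `f`.
      obtain ⟨⟨_, N, rfl⟩, hN⟩ := (IsLocalization.eq_iff_exists (Submonoid.powers f) _).mp h1.symm
      have h2 := cartierIdeal_le_of_pow_mul_eq (pow_ne_zero (t + 1) hp.ne_zero)
        (Nat.sub_ne_zero_of_lt hlt') hN
      have h3 := cartierIdeal_pow_eq p hF t 1 (f ^ (p ^ t - 1))
      rw [← hpow, pow_one] at h3
      rw [← h3]
      exact h2.trans ((cartierIdeal_le_iff p hF (t + 1) _ _).mpr ⟨_, hlin, rfl⟩)
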